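/- Let $a,b>0$, let $1\le r\le n$ be integers, $\tau>0$, $\zeta\ge 0$, and let $C_s,r_s,C_\tau,C_r,a_0,a_1,a_2$ be real cost parameters. Let $\lambda$ have the gamma prior with density $\frac{b^a}{\Gamma(a)}\lambda^{a-1}e^{-b\lambda}$, $\lambda>0$, and, given $\lambda$, let $X_1,\dots,X_n$ be independent exponential lifetimes with rate $\lambda$ and order statistics $X_{(1)}\le\dots\le X_{(n)}$. Under Type-I hybrid censoring the experiment stops at $\tau^*=\min\{X_{(r)},\tau\}$. Let $M=\min\{r,\#\{i: X_i\le\tau\}\}$ be the number of observed failures, and put $\widehat\lambda=0$ if $M=0$, $$\widehat\lambda=\frac{M}{\sum_{i=1}^{M}X_{(i)}+(n-M)\tau}\ \text{ if } 1\le M\le r-1,\qquad \widehat\lambda=\frac{r}{\sum_{i=1}^{r}X_{(i)}+(n-r)X_{(r)}}\ \text{ if } M=r.$$ The batch is accepted if $\widehat\lambda<\zeta$ and rejected if $\widehat\lambda\ge\zeta$. The loss is $nC_s-(n-M)r_s+\tau^*C_\tau+a_0+a_1\lambda+a_2\lambda^2$ on acceptance and $nC_s-(n-M)r_s+\tau^*C_\tau+C_r$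 on rejection. The Bayes risk $r(n,r,\tau,\zeta)$ is the expectation $E_\lambda E_{X|\lambda}$ of the loss; $\mu_i=E(\lambda^i)$. Let $C_0=C_r-a_0$, $C_1=-a_1$, $C_2=-a_2$, $\tau_{j,m}=(n-m+j)\frac{\tau}{m}$, $C_{j,m}=b+m\tau_{j,m}$, $\zeta^*=\max\{\frac1{n\tau},\zeta\}$, $C^*_{j,m}=\frac{m(1/\zeta^*-\tau_{j,m})}{C_{j,m}}$, $S^*_{j,m}=\frac{C^*_{j,m}}{1+C^*_{j,m}}$, and $$R_{l,j,m}=\frac{\Gamma(a+l)}{C_{j,m}^{a+l}}\,I_{S^*_{j,m}}(m,a+l),$$ where $I_x(\alpha,\beta)$ is the cumulative distribution function of the beta distribution, i.e. the regularized incomplete beta function for $0\le x\le1$, and $I_x=0$ for $x\le0$. Let $\mathbf 1_{(\zeta=0)}$ be $1$ if $\zeta=0$ and $0$ otherwise. Then the loss, $M$, $\tau^*$, $\lambda$ and $\lambda^2$ are integrable, and $$\begin{aligned} r(n,r,\tau,\zeta)={}&n(C_s-r_s)+E(M)r_s+E(\tau^*)C_\tau+a_0+a_1\mu_1+a_2\mu_2\\&+\sum_{l=0}^{2}C_l\frac{b^a}{\Gamma(a)}\Big\{\frac{\Gamma(a+l)}{(b+n\tau)^{a+l}}\mathbf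 1_{(\zeta=0)}+\sum_{m=1}^{r-1}\sum_{j=0}^{m}\binom nm\binom mj(-1)^jR_{l,j,m}+R_{l,r-n,r}\\&\qquad+\sum_{k=1}^{r}\binom nr\binom{r-1}{k-1}(-1)^k\frac{r}{n-r+k}R_{l,k,r}\Big\},\end{aligned}$$ where $$E(M)=\sum_{m=1}^{r-1}\sum_{j=0}^{m}m\binom nm\binom mj(-1)^j\frac{b^a}{(b+(n-m+j)\tau)^a}+\sum_{k=r}^{n}\sum_{j=0}^{k}r\binom nk\binom kj(-1)^j\frac{b^a}{(b+(n-k+j)\tau)^a}$$ and, if $a\ne1$, $$\begin{aligned}E(\tau^*)={}&r\binom nr\sum_{j=0}^{r-1}\binom{r-1}{j}(-1)^{r-1-j}\Big\{\frac{b}{(n-j)^2(a-1)}-\frac{\tau b^a}{(n-j)((n-j)\tau+b)^a}-\frac{b^a}{(n-j)^2(a-1)((n-j)\tau+b)^{a-1}}\Big\}\\&+\sum_{k=0}^{r-1}\sum_{j=0}^{k}\tau\binom nk\binom kj(-1)^j\frac{b^a}{(b+(n-k+j)\tau)^a}.\end{aligned}$$ -/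

import Mathlib

open MeasureTheory ProbabilityTheory

noncomputable section

namespace HybridPlan

/-! ### The experiment -/

/-- The `k`-th order statistic `X_(k)` (1-based, `1 ≤ k ≤ n`) of a sample `x` of size `n`:
the `k`-th entry of the sample sorted in increasing order. Only `1 ≤ k ≤ n` is ever used. -/
def orderStat {n : ℕ} (x : Fin n → ℝ) (k : ℕ) : ℝ :=
  if h : k - 1 < n then x (Tuple.sort x ⟨k - 1, h⟩) else 0

/-- The number `M` of failures observed in the experiment, which stops at the `r`-th failure
or at time `τ`: the number of lifetimes that are at most `τ`, but at most `r` of them. -/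
def numFailures {n : ℕ} (r : ℕ) (τ : ℝ) (x : Fin n → ℝ) : ℕ :=
  min r {i : Fin n | x i ≤ τ}.ncard

/-- The duration `τ* = min {X_(r), τ}` of the experiment. -/
def duration {n : ℕ} (r : ℕ) (τ : ℝ) (x : Fin n → ℝ) : ℝ :=
  min (orderStat x r) τ

/-- The estimator of the failure rate: `0` if there was no failure, and else the maximum
likelihood estimator, i.e. the number of failures divided by the total time on test. -/
def rateEstimator {n : ℕ} (r : ℕ) (τ : ℝ) (x : Fin n → ℝ) : ℝ :=
  let M := numFailures r τ x
  if M = 0 then 0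
  else if M < r then
    (M : ℝ) / ((∑ i ∈ Finset.Icc 1 M, orderStat x i) + ((n : ℝ) - M) * τ)
  else
    (r : ℝ) / ((∑ i ∈ Finset.Icc 1 r, orderStat x i) + ((n : ℝ) - r) * orderStat x r)

/-- The two actions: accept the batch (`d₀`) or reject it (`d₁`). -/
inductive Action where
  | accept : Action
  | reject : Action

/-- The decision function with threshold `ζ`: accept iff the estimate is below `ζ`. -/
def decision {n : ℕ} (r : ℕ) (τ ζ : ℝ) (x : Fin n → ℝ) : Action :=
  if rateEstimator r τ x < ζ then Action.accept else Action.reject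

/-- The cost parameters: `Cs` per inspected item, `rs` salvage value of an item that did not fail,
`Ct` per unit of time, `Cr` for rejecting the batch, and the coefficients of the cost
`a₀ + a₁ λ + a₂ λ²` of accepting the batch. -/
structure Costs where
  Cs : ℝ
  rs : ℝ
  Ct : ℝ
  Cr : ℝ
  a₀ : ℝ
  a₁ : ℝ
  a₂ : ℝ

/-- The cost of taking an action, when the failure rate is `lam`. -/
def actionCost (c : Costs) (lam : ℝ) : Action → ℝ
  | Action.accept => c.a₀ + c.a₁ * lam + c.a₂ * lam ^ 2
  | Action.reject => c.Cr

/-- The loss of the plan `(n, r, τ, ζ)` when the failure rate is `lam` and the lifetimes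
are `x`. -/
def loss (c : Costs) (n r : ℕ) (τ ζ lam : ℝ) (x : Fin n → ℝ) : ℝ :=
  n * c.Cs - ((n : ℝ) - numFailures r τ x) * c.rs + duration r τ x * c.Ct
    + actionCost c lam (decision r τ ζ x)

/-! ### Expectations under the prior and the sampling law -/

/-- The law of `n` independent exponential lifetimes of rate `lam`. -/
def sampleLaw (n : ℕ) (lam : ℝ) : Measure (Fin n → ℝ) :=
  Measure.pi fun _ : Fin n => expMeasure lam

/-- `E_λ E_{X|λ} f(λ, X)`, where `λ` has the gamma distribution of shape `a` and rate `b`, and,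
given `λ`, the components of `X` are `n` independent exponential variables of rate `λ`. -/
def bayesExp (a b : ℝ) (n : ℕ) (f : ℝ → (Fin n → ℝ) → ℝ) : ℝ :=
  ∫ lam, (∫ x, f lam x ∂(sampleLaw n lam)) ∂(gammaMeasure a b)

/-- The integrability that gives `bayesExp a b n f` its meaning. -/
def BayesIntegrable (a b : ℝ) (n : ℕ) (f : ℝ → (Fin n → ℝ) → ℝ) : Prop :=
  (∀ lam : ℝ, 0 < lam → Integrable (f lam) (sampleLaw n lam)) ∧
  Integrable (fun lam => ∫ x, |f lam x| ∂(sampleLaw n lam)) (gammaMeasure a b) ∧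
  Integrable (fun lam => ∫ x, f lam x ∂(sampleLaw n lam)) (gammaMeasure a b)

/-- The Bayes risk of the plan `(n, r, τ, ζ)`. -/
def bayesRisk (c : Costs) (a b : ℝ) (n r : ℕ) (τ ζ : ℝ) : ℝ :=
  bayesExp a b n (loss c n r τ ζ)

/-- The expected number `E(M)` of observed failures. -/
def expFailures (a b : ℝ) (n r : ℕ) (τ : ℝ) : ℝ :=
  bayesExp a b n fun _ x => (numFailures r τ x : ℝ)

/-- The expected duration `E(τ*)` of the experiment. -/
def expDuration (a b : ℝ) (n r : ℕ) (τ : ℝ) : ℝ :=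
  bayesExp a b n fun _ x => duration r τ x

/-- The prior moment `μ_i = E(λ^i)`. -/
def priorMoment (a b : ℝ) (i : ℕ) : ℝ :=
  ∫ lam, lam ^ i ∂(gammaMeasure a b)

/-! ### The ingredients of the closed form -/

/-- The regularized incomplete beta function `I_x(α, β) = B_x(α, β) / B(α, β)`, where `B_x` is the
integral over `(0, x]`, so that `I_x = 0` for `x ≤ 0`: for `x ≤ 1` this is the cumulative
distribution function of the beta distribution. -/
def regIncBeta (x α β : ℝ) : ℝ :=
  (∫ u in Set.Ioc 0 x, u ^ (α - 1) * (1 - u) ^ (β - 1)) / ProbabilityTheory.beta α β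

/-- `τ_{j,m} = (n - m + j) τ / m`; here `j` may be negative. -/
def tauJM (n : ℕ) (τ : ℝ) (j : ℤ) (m : ℕ) : ℝ :=
  ((n : ℝ) - m + j) * (τ / m)

/-- `C_{j,m} = b + m τ_{j,m}`. -/
def cJM (b : ℝ) (n : ℕ) (τ : ℝ) (j : ℤ) (m : ℕ) : ℝ :=
  b + m * tauJM n τ j m

/-- `ζ* = max {1 / (n τ), ζ}`. -/
def zetaStar (n : ℕ) (τ ζ : ℝ) : ℝ :=
  max (1 / (n * τ)) ζ

/-- `C*_{j,m} = m (1 / ζ* - τ_{j,m}) / C_{j,m}`. -/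
def cStarJM (b : ℝ) (n : ℕ) (τ ζ : ℝ) (j : ℤ) (m : ℕ) : ℝ :=
  m * (1 / zetaStar n τ ζ - tauJM n τ j m) / cJM b n τ j m

/-- `S*_{j,m} = C*_{j,m} / (1 + C*_{j,m})`. -/
def sStarJM (b : ℝ) (n : ℕ) (τ ζ : ℝ) (j : ℤ) (m : ℕ) : ℝ :=
  cStarJM b n τ ζ j m / (1 + cStarJM b n τ ζ j m)

/-- `R_{l,j,m} = Γ(a + l) / C_{j,m}^(a + l) * I_{S*_{j,m}}(m, a + l)`. -/
def rLJM (a b : ℝ) (n : ℕ) (τ ζ : ℝ) (l : ℕ) (j : ℤ) (m : ℕ) : ℝ :=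
  Real.Gamma (a + l) / cJM b n τ j m ^ (a + l) * regIncBeta (sStarJM b n τ ζ j m) m (a + l)

/-- The coefficients `C_0 = C_r - a_0`, `C_1 = -a_1`, `C_2 = -a_2`. -/
def riskCoeff (c : Costs) : Fin 3 → ℝ :=
  ![c.Cr - c.a₀, -c.a₁, -c.a₂]

end HybridPlan

end

namespace HybridPlan

/-! ### Order statistics -/

/-! The loss is affine in `M`, `τ*` and the indicator of rejection, and the coefficient of that
indicator is the polynomial `C₀ + C₁ λ + C₂ λ²` (`loss_eq`). So everything reduces to the prior
means of `M`, of `τ*` and of `λ^l P(reject | λ)`, for `l ≤ 2`.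

Rejection. With `T` the total time on test, the estimate is `M / T`. Since `T ≤ n τ`, rejection with
`M ≥ 1` is the event `T ≤ M / ζ*`; with `M = 0` it occurs only for `ζ = 0` (`rejectInd_eq`).

Fixed `λ`. Let `G_m` be the distribution function of a sum of `m` exponentials (`sumCDF`). By lack
of memory, an exponential restricted to `[0, t]` is the full law minus `e^{-λ t}` times its
translate by `t`. Inducting over the coordinates, the joint law of the number of lifetimes up to `t`
and of their sum becomes a binomial alternating sum of terms `e^{-λ j t} G_m(s - j t)`
(`integral_countInd`). If `M = r`, the `r`-th failure is the unique coordinate with exactly `r`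
lifetimes up to it. Conditioning on its value (`integral_orderStat`) and integrating that value over
`[0, τ]` is one more convolution. The terms from the endpoint `0` add up to a single `G_r`, those
from `τ` give the sum over `k` (`integral_orderStat_le`).

Prior. `1 - G_m` is a Poisson sum, whose gamma mixture is a negative binomial sum, and this is the
complement of a regularized incomplete beta function with integer first parameter
(`regIncBeta_natCast`, `hasMean_sumCDF`). This produces the `R_{l,j,m}`. The means of `M` and `τ*`
come from the same laws of the count and of `X_(r)`. -/

/-- The number of entries of `x` that are at most `t`. -/
noncomputable def countLE {n : ℕ} (t : ℝ) (x : Fin n → ℝ) : ℕ := ∑ i, if x i ≤ t then 1 else 0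

/-- The sum of the entries of `x` that are at most `t`. -/
noncomputable def sumLE {n : ℕ} (t : ℝ) (x : Fin n → ℝ) : ℝ := ∑ i, if x i ≤ t then x i else 0

lemma countLE_eq_card {n : ℕ} (t : ℝ) (x : Fin n → ℝ) :
    countLE t x = (Finset.univ.filter fun i => x i ≤ t).card := by
  simp [countLE]

lemma countLE_le {n : ℕ} (t : ℝ) (x : Fin n → ℝ) : countLE t x ≤ n := by
  rw [countLE_eq_card]
  exact (Finset.card_le_univ _).trans (by simp)

lemma countLE_comp_perm {n : ℕ} (t : ℝ) (x : Fin n → ℝ) (σ : Equiv.Perm (Fin n)) :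
    countLE t (x ∘ σ) = countLE t x :=
  Equiv.sum_comp σ fun i => if x i ≤ t then 1 else 0

lemma sumLE_comp_perm {n : ℕ} (t : ℝ) (x : Fin n → ℝ) (σ : Equiv.Perm (Fin n)) :
    sumLE t (x ∘ σ) = sumLE t x :=
  Equiv.sum_comp σ fun i => if x i ≤ t then x i else 0

lemma numFailures_eq {n : ℕ} (r : ℕ) (τ : ℝ) (x : Fin n → ℝ) :
    numFailures r τ x = min r (countLE τ x) := by
  rw [numFailures, countLE_eq_card, ← Set.ncard_coe_finset (Finset.univ.filter fun i => x i ≤ τ),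
    Finset.coe_filter_univ]

lemma orderStat_succ {n : ℕ} (x : Fin n → ℝ) (k : Fin n) :
    orderStat x (k + 1) = (x ∘ Tuple.sort x) k := by
  simp [orderStat]

/-- Sorting is traded for counting, which is invariant under permutations. Comparisons of order
statistics with a threshold, and their measurability, rest on this. -/
lemma sort_le_iff {n : ℕ} (x : Fin n → ℝ) (k : Fin n) (t : ℝ) :
    (x ∘ Tuple.sort x) k ≤ t ↔ (k : ℕ) < countLE t x := by
  have h := Tuple.lt_card_le_iff_apply_le_of_monotone (j := k) (a := t) (Tuple.monotone_sort x)
  rw [← h, ← countLE_comp_perm t x (Tuple.sort x), countLE_eq_card]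

lemma orderStat_le_iff {n k : ℕ} (x : Fin n → ℝ) (hk : 1 ≤ k) (hkn : k ≤ n) (t : ℝ) :
    orderStat x k ≤ t ↔ k ≤ countLE t x := by
  obtain ⟨k, rfl⟩ := Nat.exists_eq_add_of_le' hk
  rw [show k + 1 = ((⟨k, hkn⟩ : Fin n) : ℕ) + 1 from rfl, orderStat_succ, sort_le_iff]
  exact Nat.lt_iff_add_one_le

/-- Ties are harmless: entries equal to `t` are all included on both sides. -/
lemma sum_orderStat {n : ℕ} (x : Fin n → ℝ) (t : ℝ) :
    ∑ i ∈ Finset.Icc 1 (countLE t x), orderStat x i = sumLE t x := by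
  rw [← sumLE_comp_perm t x (Tuple.sort x), sumLE]
  simp_rw [sort_le_iff, ← orderStat_succ]
  rw [Fin.sum_univ_eq_sum_range (fun k => if k < countLE t x then orderStat x (k + 1) else 0) n,
    ← Finset.sum_filter]
  have : (Finset.range n).filter (fun k => k < countLE t x) = Finset.range (countLE t x) := by
    ext k
    have := countLE_le t x
    simp only [Finset.mem_filter, Finset.mem_range]
    omega
  rw [this, Finset.range_eq_Ico, Finset.sum_Ico_add' (fun k => orderStat x k)]
  rfl

lemma exists_eq_orderStat {n k : ℕ} (x : Fin n → ℝ) (hk : 1 ≤ k) (hkn : k ≤ n) :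
    ∃ i, orderStat x k = x i := by
  obtain ⟨k, rfl⟩ := Nat.exists_eq_add_of_le' hk
  exact ⟨_, orderStat_succ x ⟨k, hkn⟩⟩

lemma orderStat_countLE {n : ℕ} (x : Fin n → ℝ) (i : Fin n) :
    orderStat x (countLE (x i) x) = x i := by
  have hpos : 1 ≤ countLE (x i) x := by
    rw [countLE_eq_card, Nat.one_le_iff_ne_zero, Finset.card_ne_zero]
    exact ⟨i, by simp⟩
  refine le_antisymm ((orderStat_le_iff x hpos (countLE_le _ _) _).2 le_rfl) ?_
  by_contra! hlt
  have h := (orderStat_le_iff x hpos (countLE_le _ _) _).1 le_rfl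
  refine absurd h (not_le.2 ?_)
  conv_rhs => rw [countLE_eq_card]
  rw [countLE_eq_card]
  refine Finset.card_lt_card ⟨fun j hj => ?_, fun hsub => ?_⟩
  · simp only [Finset.mem_filter, Finset.mem_univ, true_and] at hj ⊢
    exact hj.trans hlt.le
  · have := hsub (show i ∈ _ by simp)
    simp only [Finset.mem_filter, Finset.mem_univ, true_and] at this
    exact absurd hlt (not_lt.2 this)

lemma countLE_orderStat {n k : ℕ} {x : Fin n → ℝ} (hx : Function.Injective x) (hk : 1 ≤ k)
    (hkn : k ≤ n) : countLE (orderStat x k) x = k := by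
  refine le_antisymm ?_ ((orderStat_le_iff x hk hkn _).1 le_rfl)
  obtain ⟨k, rfl⟩ := Nat.exists_eq_add_of_le' hk
  by_contra! h
  have hn : k + 1 < n := h.trans_le (countLE_le _ _)
  have h1 := (sort_le_iff x ⟨k + 1, hn⟩ _).2 h
  rw [show orderStat x (k + 1) = _ from orderStat_succ x ⟨k, hkn⟩] at h1
  have h2 := Tuple.monotone_sort x (show (⟨k, hkn⟩ : Fin n) ≤ ⟨k + 1, hn⟩ by simp)
  have h3 := (hx.comp (Tuple.sort x).injective) (le_antisymm h1 h2)
  simp at h3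

/-- Without ties exactly one index realizes the `k`-th order statistic, so a single summand
survives. In this form a coordinate can be split off by Fubini. -/
lemma sum_ite_countLE {n k : ℕ} {x : Fin n → ℝ} (hx : Function.Injective x) (hk : 1 ≤ k)
    (hkn : k ≤ n) (f : ℝ → ℝ → ℝ) :
    f (orderStat x k) (∑ i ∈ Finset.Icc 1 k, orderStat x i)
      = ∑ i, if countLE (x i) x = k then f (x i) (sumLE (x i) x) else 0 := by
  obtain ⟨i₀, hi₀⟩ := exists_eq_orderStat x hk hkn
  have hc : countLE (x i₀) x = k := hi₀ ▸ countLE_orderStat hx hk hkn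
  rw [Finset.sum_eq_single i₀]
  · rw [if_pos hc, hi₀, ← sum_orderStat, hc]
  · intro i _ hne
    rw [if_neg]
    intro h
    refine hne (hx ?_)
    rw [← hi₀, ← h, orderStat_countLE]
  · simp

@[fun_prop]
lemma measurable_countLE {n : ℕ} (t : ℝ) : Measurable (countLE t : (Fin n → ℝ) → ℕ) := by
  unfold countLE
  refine Finset.measurable_sum _ fun i _ => ?_
  exact Measurable.ite (measurableSet_le (measurable_pi_apply i) measurable_const)
    measurable_const measurable_const

@[fun_prop]
lemma measurable_orderStat {n : ℕ} (k : ℕ) : Measurable fun x : Fin n → ℝ => orderStat x k := by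
  by_cases h : k - 1 < n
  · have : (fun x : Fin n → ℝ => orderStat x k)
        = fun x => orderStat x (((⟨k - 1, h⟩ : Fin n) : ℕ) + 1) := by
      ext x; simp [orderStat]
    rw [this]
    refine measurable_of_Iic fun t => ?_
    have : (fun x : Fin n → ℝ => orderStat x (((⟨k - 1, h⟩ : Fin n) : ℕ) + 1)) ⁻¹' Set.Iic t
        = {x | k - 1 < countLE t x} := by
      ext x
      rw [Set.mem_preimage, Set.mem_Iic, orderStat_succ, sort_le_iff]
      rfl
    rw [this]
    exact measurableSet_lt measurable_const (measurable_countLE t)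
  · simp only [orderStat, dif_neg h]
    exact measurable_const

@[fun_prop]
lemma measurable_numFailures {n : ℕ} (r : ℕ) (τ : ℝ) :
    Measurable (numFailures r τ : (Fin n → ℝ) → ℕ) := by
  have : (numFailures r τ : (Fin n → ℝ) → ℕ) = fun x => min r (countLE τ x) :=
    funext (numFailures_eq r τ)
  rw [this]
  fun_prop

@[fun_prop]
lemma measurable_duration {n : ℕ} (r : ℕ) (τ : ℝ) :
    Measurable (duration r τ : (Fin n → ℝ) → ℝ) := by
  unfold duration
  fun_prop

/-- The total time on test at the end of the experiment. -/
noncomputable def timeOnTest {n : ℕ} (r : ℕ) (τ : ℝ) (x : Fin n → ℝ) : ℝ :=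
  if countLE τ x < r then sumLE τ x + ((n : ℝ) - countLE τ x) * τ
  else (∑ i ∈ Finset.Icc 1 r, orderStat x i) + ((n : ℝ) - r) * orderStat x r

@[fun_prop]
lemma measurable_sumLE {n : ℕ} (t : ℝ) : Measurable (sumLE t : (Fin n → ℝ) → ℝ) := by
  unfold sumLE
  refine Finset.measurable_sum _ fun i _ => ?_
  exact Measurable.ite (measurableSet_le (measurable_pi_apply i) measurable_const)
    (measurable_pi_apply i) measurable_const

@[fun_prop]
lemma measurable_timeOnTest {n : ℕ} (r : ℕ) (τ : ℝ) :
    Measurable (timeOnTest r τ : (Fin n → ℝ) → ℝ) := by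
  refine Measurable.ite (measurableSet_lt (measurable_countLE τ) measurable_const) ?_ ?_
  · have : Measurable fun x : Fin n → ℝ => (countLE τ x : ℝ) :=
      measurable_from_nat.comp (measurable_countLE τ)
    fun_prop
  · fun_prop

/-- The case `M = 0` needs no branch of its own, because `0 / T = 0`. -/
lemma rateEstimator_eq {n : ℕ} (r : ℕ) (τ : ℝ) (x : Fin n → ℝ) :
    rateEstimator r τ x = (numFailures r τ x : ℝ) / timeOnTest r τ x := by
  rw [rateEstimator, timeOnTest]
  simp only [numFailures_eq]
  split_ifs with h1 h2 h3 h4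
  · simp [h1]
  · simp [h1]
  · rw [min_eq_right h4.le, sum_orderStat]
  · omega
  · omega
  · rw [min_eq_left (by omega)]

@[fun_prop]
lemma measurable_rateEstimator {n : ℕ} (r : ℕ) (τ : ℝ) :
    Measurable (rateEstimator r τ : (Fin n → ℝ) → ℝ) := by
  have : (rateEstimator r τ : (Fin n → ℝ) → ℝ)
      = fun x => (numFailures r τ x : ℝ) / timeOnTest r τ x := funext (rateEstimator_eq r τ)
  rw [this]
  exact (measurable_from_nat.comp (measurable_numFailures r τ)).div (measurable_timeOnTest r τ)

/-! ### The exponential law -/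

lemma integral_gammaMeasure {a b : ℝ} (ha : 0 < a) (hb : 0 < b) (f : ℝ → ℝ) :
    ∫ x, f x ∂(gammaMeasure a b)
      = ∫ x in Set.Ioi 0, b ^ a / Real.Gamma a * x ^ (a - 1) * Real.exp (-(b * x)) * f x := by
  have h : gammaMeasure a b = volume.withDensity fun x => ENNReal.ofReal (gammaPDFReal a b x) := rfl
  rw [h, integral_withDensity_eq_integral_toReal_smul
    (measurable_gammaPDFReal a b).ennreal_ofReal (by simp),
    ← setIntegral_eq_integral_of_forall_compl_eq_zero (s := Set.Ici 0),
    integral_Ici_eq_integral_Ioi]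
  · refine setIntegral_congr_fun measurableSet_Ioi fun x hx => ?_
    have hx' : (0 : ℝ) ≤ x := le_of_lt hx
    simp only [smul_eq_mul, ENNReal.toReal_ofReal (gammaPDFReal_nonneg ha hb x)]
    rw [gammaPDFReal, if_pos hx']
  · intro x hx
    simp only [Set.mem_Ici, not_le] at hx
    simp [gammaPDFReal, not_le.2 hx]

lemma integrable_gammaMeasure {a b : ℝ} (ha : 0 < a) (hb : 0 < b) (f : ℝ → ℝ) :
    Integrable f (gammaMeasure a b) ↔ IntegrableOn
      (fun x => b ^ a / Real.Gamma a * x ^ (a - 1) * Real.exp (-(b * x)) * f x) (Set.Ioi 0) := by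
  have h : gammaMeasure a b = volume.withDensity fun x => ENNReal.ofReal (gammaPDFReal a b x) := rfl
  rw [h, integrable_withDensity_iff_integrable_smul'
    (measurable_gammaPDFReal a b).ennreal_ofReal (by simp), ← integrableOn_Ici_iff_integrableOn_Ioi,
    ← integrableOn_univ, ← Set.Iio_union_Ici (a := (0 : ℝ)), integrableOn_union]
  rw [and_iff_right]
  · refine integrableOn_congr_fun (fun x hx => ?_) measurableSet_Ici
    have hx' : (0 : ℝ) ≤ x := hx
    simp only [smul_eq_mul, ENNReal.toReal_ofReal (gammaPDFReal_nonneg ha hb x)]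
    rw [gammaPDFReal, if_pos hx']
  · refine (integrableOn_zero (ε' := ℝ)).congr_fun (fun x hx => ?_) measurableSet_Iio
    simp only [Set.mem_Iio] at hx
    simp [gammaPDFReal, not_le.2 hx]

lemma ae_pos_gammaMeasure (a b : ℝ) : ∀ᵐ x ∂(gammaMeasure a b), 0 < x := by
  have h0 : gammaMeasure a b ≪ volume := withDensity_absolutelyContinuous _ _
  have h1 : ∀ᵐ x ∂(gammaMeasure a b), x ≠ 0 := h0.ae_le (Measure.ae_ne volume 0)
  have h2 : ∀ᵐ x ∂(gammaMeasure a b), 0 ≤ x := by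
    rw [ae_iff, gammaMeasure, withDensity_apply' ]
    simp only [not_le]
    exact lintegral_gammaPDF_of_nonpos le_rfl
  filter_upwards [h1, h2] with x hx1 hx2 using lt_of_le_of_ne hx2 hx1.symm

lemma integral_expMeasure {lam : ℝ} (hl : 0 < lam) (f : ℝ → ℝ) :
    ∫ x, f x ∂(expMeasure lam) = ∫ x in Set.Ioi 0, lam * Real.exp (-(lam * x)) * f x := by
  rw [expMeasure, integral_gammaMeasure one_pos hl]
  simp

instance nullSingletonClass_gammaMeasure (a b : ℝ) : NullSingletonClass (gammaMeasure a b) :=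
  nullSingletonClass_withDensity (μ := volume) (gammaPDF a b)

instance nullSingletonClass_expMeasure (lam : ℝ) : NullSingletonClass (expMeasure lam) :=
  nullSingletonClass_gammaMeasure 1 lam

lemma setIntegral_Iic_expMeasure {lam t : ℝ} (hl : 0 < lam) (ht : 0 ≤ t) (f : ℝ → ℝ) :
    ∫ x in Set.Iic t, f x ∂(expMeasure lam)
      = ∫ x in 0..t, lam * Real.exp (-(lam * x)) * f x := by
  rw [← integral_indicator measurableSet_Iic, integral_expMeasure hl,
    intervalIntegral.integral_of_le ht, ← Set.Ioi_inter_Iic,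
    ← setIntegral_indicator measurableSet_Iic]
  refine integral_congr_ae (.of_forall fun x => ?_)
  by_cases hx : x ∈ Set.Iic t <;> simp [hx]

/-- Lack of memory, from translation invariance of Lebesgue measure. -/
lemma setIntegral_Ioi_expMeasure {lam t : ℝ} (hl : 0 < lam) (ht : 0 ≤ t) (f : ℝ → ℝ) :
    ∫ x in Set.Ioi t, f x ∂(expMeasure lam)
      = Real.exp (-(lam * t)) * ∫ x, f (x + t) ∂(expMeasure lam) := by
  rw [← integral_indicator measurableSet_Ioi, integral_expMeasure hl, integral_expMeasure hl]
  have h : ∀ x, lam * Real.exp (-(lam * x)) * (Set.Ioi t).indicator f x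
      = (Set.Ioi t).indicator (fun x => lam * Real.exp (-(lam * x)) * f x) x := fun x => by
    by_cases hx : x ∈ Set.Ioi t <;> simp [hx]
  simp only [h]
  rw [setIntegral_indicator measurableSet_Ioi, Set.Ioi_inter_Ioi, sup_of_le_right ht,
    ← integral_const_mul]
  rw [← integral_indicator measurableSet_Ioi, ← integral_add_right_eq_self _ t,
    ← integral_indicator measurableSet_Ioi]
  refine integral_congr_ae (.of_forall fun x => ?_)
  by_cases hx : 0 < x
  · simp only [Set.indicator_of_mem, Set.mem_Ioi, hx, lt_add_iff_pos_left]
    rw [mul_add, neg_add, Real.exp_add]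
    ring
  · simp [Set.indicator, hx]

lemma setIntegral_Iic_expMeasure_eq_sub {lam t : ℝ} (hl : 0 < lam) (ht : 0 ≤ t) {f : ℝ → ℝ}
    (hf : Integrable f (expMeasure lam)) :
    ∫ x in Set.Iic t, f x ∂(expMeasure lam)
      = ∫ x, f x ∂(expMeasure lam)
        - Real.exp (-(lam * t)) * ∫ x, f (x + t) ∂(expMeasure lam) := by
  rw [← setIntegral_Ioi_expMeasure hl ht, ← integral_add_compl measurableSet_Iic hf, Set.compl_Iic]
  ring

/-- For `λ > 0`, the probability that a sum of `m` independent exponential variables of rate `λ`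
is at most `s`. -/
noncomputable def sumCDF (m : ℕ) (lam s : ℝ) : ℝ :=
  if 0 ≤ s then 1 - (∑ k ∈ Finset.range m, (lam * s) ^ k / k.factorial) * Real.exp (-(lam * s))
  else 0

@[fun_prop]
lemma measurable_sumCDF (m : ℕ) (lam : ℝ) : Measurable (sumCDF m lam) :=
  Measurable.ite measurableSet_Ici (by fun_prop) measurable_const

lemma sumCDF_mem {lam : ℝ} (hl : 0 < lam) (m : ℕ) (s : ℝ) :
    0 ≤ sumCDF m lam s ∧ sumCDF m lam s ≤ 1 := by
  unfold sumCDF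
  split_ifs with hs
  · have h1 : 0 ≤ lam * s := by positivity
    have h2 : (∑ k ∈ Finset.range m, (lam * s) ^ k / k.factorial) * Real.exp (-(lam * s)) ≤ 1 := by
      rw [Real.exp_neg, ← div_eq_mul_inv, div_le_one (Real.exp_pos _)]
      exact Real.sum_le_exp_of_nonneg h1 m
    have h3 : 0 ≤ (∑ k ∈ Finset.range m, (lam * s) ^ k / k.factorial) * Real.exp (-(lam * s)) := by
      positivity
    constructor <;> linarith
  · simp

lemma norm_sumCDF_le {lam : ℝ} (hl : 0 < lam) (m : ℕ) (s : ℝ) : ‖sumCDF m lam s‖ ≤ 1 := by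
  rw [Real.norm_of_nonneg (sumCDF_mem hl m s).1]
  exact (sumCDF_mem hl m s).2

/-- The integrand vanishes beyond `s`. On `[0, s]` the two exponentials multiply to the constant
`e^{-λ s}`, so what is left to integrate is elementary. -/
lemma integral_sumCDF_sub {lam : ℝ} (hl : 0 < lam) (m : ℕ) (s : ℝ) :
    ∫ x, sumCDF m lam (s - x) ∂(expMeasure lam) = sumCDF (m + 1) lam s := by
  rw [integral_expMeasure hl]
  by_cases hs : 0 ≤ s
  · have h1 : ∫ x in Set.Ioi 0, lam * Real.exp (-(lam * x)) * sumCDF m lam (s - x)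
        = ∫ x in 0..s, lam * Real.exp (-(lam * x)) * sumCDF m lam (s - x) := by
      rw [intervalIntegral.integral_of_le hs]
      refine (setIntegral_eq_of_subset_of_forall_sdiff_eq_zero measurableSet_Ioi
        Set.Ioc_subset_Ioi_self fun x hx => ?_)
      have : s < x := by
        by_contra! h
        exact hx.2 ⟨hx.1, h⟩
      rw [sumCDF, if_neg (by linarith), mul_zero]
    -- Each power of `λ (s - x)` is raised by one; the term `k = 0` of the new sum comes from
    -- `-e^{-λ x}` at `x = s`.
    have h2 : ∀ x ∈ Set.uIcc 0 s, HasDerivAt (fun x => -Real.exp (-(lam * x))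
        + (∑ k ∈ Finset.range m, (lam * (s - x)) ^ (k + 1) / (k + 1).factorial)
          * Real.exp (-(lam * s))) (lam * Real.exp (-(lam * x)) * sumCDF m lam (s - x)) x := by
      intro x hx
      rw [Set.uIcc_of_le hs] at hx
      have h3 : HasDerivAt (fun x : ℝ => lam * (s - x)) (-lam) x := by
        simpa using ((hasDerivAt_id x).const_sub s).const_mul lam
      have h4 : HasDerivAt (fun x => ∑ k ∈ Finset.range m,
          (lam * (s - x)) ^ (k + 1) / ((k + 1).factorial : ℝ))
          (∑ k ∈ Finset.range m, -lam * ((lam * (s - x)) ^ k / (k.factorial : ℝ))) x := by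
        refine HasDerivAt.fun_sum fun k _ => ?_
        convert! (h3.pow (k + 1)).div_const ((k + 1).factorial : ℝ) using 1
        rw [Nat.factorial_succ]
        have : (k.factorial : ℝ) ≠ 0 := by positivity
        have : (k : ℝ) + 1 ≠ 0 := by positivity
        push_cast
        field_simp
      convert! hasDerivAt_neg_exp_mul_exp.add (h4.mul_const (Real.exp (-(lam * s)))) using 1
      rw [sumCDF, if_pos (by linarith [hx.2]), ← Finset.mul_sum]
      have : Real.exp (-(lam * s)) = Real.exp (-(lam * x)) * Real.exp (-(lam * (s - x))) := by
        rw [← Real.exp_add]; ring_nf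
      rw [this]
      ring
    rw [h1, intervalIntegral.integral_eq_sub_of_hasDerivAt h2, sumCDF, if_pos hs,
      Finset.sum_range_succ']
    · simp
      ring
    · have : ContinuousOn (fun x => lam * Real.exp (-(lam * x)) * (1 -
          (∑ k ∈ Finset.range m, (lam * (s - x)) ^ k / k.factorial) * Real.exp (-(lam * (s - x)))))
          (Set.uIcc 0 s) := by fun_prop
      refine this.intervalIntegrable.congr_ae ?_
      refine (ae_restrict_iff' measurableSet_uIoc).2 (.of_forall fun x hx => ?_)
      rw [Set.uIoc_of_le hs] at hx
      simp only
      rw [sumCDF, if_pos (by linarith [hx.2])]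
  · rw [sumCDF, if_neg hs]
    refine setIntegral_eq_zero_of_forall_eq_zero fun x hx => ?_
    rw [sumCDF, if_neg, mul_zero]
    simp only [Set.mem_Ioi] at hx
    linarith

/-- The alternating sum that comes from truncating `m` exponential variables at `t`. -/
noncomputable def truncSum (F : ℕ → ℝ → ℝ) (lam t : ℝ) (m : ℕ) (s : ℝ) : ℝ :=
  ∑ j ∈ Finset.range (m + 1), (m.choose j : ℝ) * (-1) ^ j * Real.exp (-(lam * (j * t)))
    * F m (s - j * t)

/-- The family of functions `F m` is bounded and reproduced by convolution with the exponential
law. -/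
structure IsExpFamily (lam : ℝ) (F : ℕ → ℝ → ℝ) : Prop where
  measurable : ∀ m, Measurable (F m)
  norm_le : ∀ m s, ‖F m s‖ ≤ 1
  conv : ∀ m s, ∫ x, F m (s - x) ∂(expMeasure lam) = F (m + 1) s

lemma isExpFamily_sumCDF {lam : ℝ} (hl : 0 < lam) : IsExpFamily lam fun m => sumCDF m lam :=
  ⟨fun m => measurable_sumCDF m lam, norm_sumCDF_le hl, integral_sumCDF_sub hl⟩

/-- The trivial family lets the argument for the joint law of count and sum also yield the law of
the count alone. -/
lemma isExpFamily_one {lam : ℝ} (hl : 0 < lam) : IsExpFamily lam fun _ _ => 1 := by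
  have := isProbabilityMeasure_expMeasure hl
  exact ⟨fun _ => measurable_const, by simp, by simp⟩

lemma IsExpFamily.integrable {lam : ℝ} (hl : 0 < lam) {F : ℕ → ℝ → ℝ} (hF : IsExpFamily lam F)
    (m : ℕ) (s : ℝ) : Integrable (fun x => F m (s - x)) (expMeasure lam) := by
  have := isProbabilityMeasure_expMeasure hl
  refine Integrable.of_bound ((hF.measurable m).comp (by fun_prop)).aestronglyMeasurable 1
    (.of_forall fun x => hF.norm_le m _)

/-- Adding one more variable truncated at `t` replaces each term by itself minus its translate by
`t`, and Pascal's rule collects the coefficients. -/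
lemma setIntegral_truncSum {lam t : ℝ} (hl : 0 < lam) (ht : 0 ≤ t) {F : ℕ → ℝ → ℝ}
    (hF : IsExpFamily lam F) (m : ℕ) (s : ℝ) :
    ∫ x in Set.Iic t, truncSum F lam t m (s - x) ∂(expMeasure lam)
      = truncSum F lam t (m + 1) s := by
  have h1 : ∀ j : ℕ, ∫ x in Set.Iic t, F m (s - x - j * t) ∂(expMeasure lam)
      = F (m + 1) (s - j * t) - Real.exp (-(lam * t)) * F (m + 1) (s - (j + 1 : ℕ) * t) := by
    intro j
    have h2 : ∀ x, s - x - j * t = s - j * t - x := fun x => by ring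
    simp only [h2]
    rw [setIntegral_Iic_expMeasure_eq_sub hl ht (hF.integrable hl _ _), hF.conv]
    have h3 : ∀ x, s - j * t - (x + t) = s - (j + 1 : ℕ) * t - x := fun x => by push_cast; ring
    simp only [h3, hF.conv]
  unfold truncSum
  rw [integral_finsetSum]
  · simp only [integral_const_mul, h1]
    set g : ℕ → ℝ := fun j => (-1) ^ j * Real.exp (-(lam * (j * t))) * F (m + 1) (s - j * t)
      with hg
    have h4 : ∀ j : ℕ, (m.choose j : ℝ) * (-1) ^ j * Real.exp (-(lam * (j * t)))
        * (F (m + 1) (s - j * t) - Real.exp (-(lam * t)) * F (m + 1) (s - (j + 1 : ℕ) * t))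
        = (m.choose j : ℝ) * g j + (m.choose j : ℝ) * g (j + 1) := by
      intro j
      have : Real.exp (-(lam * ((j + 1 : ℕ) * t)))
          = Real.exp (-(lam * (j * t))) * Real.exp (-(lam * t)) := by
        rw [← Real.exp_add]; push_cast; ring_nf
      simp only [hg, this]
      ring
    simp only [h4]
    have h5 : ∀ j : ℕ, ((m + 1).choose j : ℝ) * (-1) ^ j * Real.exp (-(lam * (j * t)))
        * F (m + 1) (s - j * t) = ((m + 1).choose j : ℝ) * g j := fun j => by
      simp only [hg]; ring
    simp only [h5]
    -- Pascal's rule: the `j = 0` terms are detached so that both sides are sums of `g (j + 1)`.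
    rw [Finset.sum_add_distrib, Finset.sum_range_succ' _ (m + 1)]
    simp only [Nat.choose_succ_succ, Nat.cast_add, add_mul, Finset.sum_add_distrib]
    rw [Finset.sum_range_succ (fun j => (m.choose (j + 1) : ℝ) * g (j + 1)) m,
      Finset.sum_range_succ' (fun j => (m.choose j : ℝ) * g j) m]
    simp
    ring
  · intro j _
    refine Integrable.const_mul ?_ _
    have h2 : ∀ x, s - x - j * t = s - j * t - x := fun x => by ring
    simp only [h2]
    exact (hF.integrable hl _ _).integrableOn

/-! ### The sampling law -/

lemma isProbabilityMeasure_sampleLaw {lam : ℝ} (hl : 0 < lam) (n : ℕ) :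
    IsProbabilityMeasure (sampleLaw n lam) := by
  have := isProbabilityMeasure_expMeasure hl
  unfold sampleLaw
  infer_instance

lemma integral_sampleLaw_succ {lam : ℝ} (hl : 0 < lam) {n : ℕ} (i : Fin (n + 1))
    {f : (Fin (n + 1) → ℝ) → ℝ} (hf : Integrable f (sampleLaw (n + 1) lam)) :
    ∫ x, f x ∂(sampleLaw (n + 1) lam)
      = ∫ t, ∫ y, f (i.insertNth t y) ∂(sampleLaw n lam) ∂(expMeasure lam) := by
  have := isProbabilityMeasure_expMeasure hl
  have := isProbabilityMeasure_sampleLaw hl n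
  have h := (measurePreserving_piFinSuccAbove (fun _ : Fin (n + 1) => expMeasure lam) i).symm
  rw [sampleLaw, ← h.integral_comp', ← sampleLaw, integral_prod]
  · rfl
  · exact (h.integrable_comp_emb (MeasurableEquiv.measurableEmbedding _)).2 hf

lemma countLE_insertNth {n : ℕ} (i : Fin (n + 1)) (t u : ℝ) (y : Fin n → ℝ) :
    countLE t (i.insertNth u y : Fin (n + 1) → ℝ) = (if u ≤ t then 1 else 0) + countLE t y := by
  simp [countLE, Fin.sum_univ_succAbove _ i]

lemma sumLE_insertNth {n : ℕ} (i : Fin (n + 1)) (t u : ℝ) (y : Fin n → ℝ) :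
    sumLE t (i.insertNth u y : Fin (n + 1) → ℝ) = (if u ≤ t then u else 0) + sumLE t y := by
  simp [sumLE, Fin.sum_univ_succAbove _ i]

lemma integrable_of_bounded {lam : ℝ} (hl : 0 < lam) {n : ℕ} {f : (Fin n → ℝ) → ℝ}
    (hf : Measurable f) (K : ℝ) (hK : ∀ x, |f x| ≤ K) : Integrable f (sampleLaw n lam) := by
  have := isProbabilityMeasure_sampleLaw hl n
  exact Integrable.of_bound hf.aestronglyMeasurable K (.of_forall hK)

open Classical in
/-- The indicator of the event that exactly `m` entries of `x` are at most `t`, and that their sum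
lies in `D`. -/
noncomputable def countInd {n : ℕ} (t : ℝ) (m : ℕ) (D : Set ℝ) (x : Fin n → ℝ) : ℝ :=
  if countLE t x = m ∧ sumLE t x ∈ D then 1 else 0

lemma measurable_countInd {n : ℕ} (t : ℝ) (m : ℕ) {D : Set ℝ} (hD : MeasurableSet D) :
    Measurable (countInd t m D : (Fin n → ℝ) → ℝ) :=
  Measurable.ite ((measurableSet_eq_fun (measurable_countLE t) measurable_const).inter
    (measurable_sumLE t hD)) measurable_const measurable_const

lemma abs_countInd_le {n : ℕ} (t : ℝ) (m : ℕ) (D : Set ℝ) (x : Fin n → ℝ) :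
    |countInd t m D x| ≤ 1 := by
  unfold countInd
  split_ifs <;> simp

lemma integrable_countInd {lam : ℝ} (hl : 0 < lam) {n : ℕ} (t : ℝ) (m : ℕ) {D : Set ℝ}
    (hD : MeasurableSet D) : Integrable (countInd t m D : (Fin n → ℝ) → ℝ) (sampleLaw n lam) :=
  integrable_of_bounded hl (measurable_countInd t m hD) 1 (abs_countInd_le t m D)

open Classical in
/-- The sets `D s` are measurable and shift with `s`, and `F` is the family of functions that
convolution with the exponential law generates from the indicator of `D s`. -/
structure IsShiftFamily (lam : ℝ) (D : ℝ → Set ℝ) (F : ℕ → ℝ → ℝ) : Prop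
    extends IsExpFamily lam F where
  measurableSet : ∀ s, MeasurableSet (D s)
  add_mem_iff : ∀ x y s, x + y ∈ D s ↔ y ∈ D (s - x)
  zero_eq : ∀ s, F 0 s = if (0 : ℝ) ∈ D s then 1 else 0

lemma isShiftFamily_Iic {lam : ℝ} (hl : 0 < lam) :
    IsShiftFamily lam Set.Iic fun m => sumCDF m lam where
  toIsExpFamily := isExpFamily_sumCDF hl
  measurableSet _ := measurableSet_Iic
  add_mem_iff x y s := by simp [le_sub_iff_add_le, add_comm]
  zero_eq s := by simp [sumCDF]

lemma isShiftFamily_univ {lam : ℝ} (hl : 0 < lam) :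
    IsShiftFamily lam (fun _ => Set.univ) fun _ _ => 1 where
  toIsExpFamily := isExpFamily_one hl
  measurableSet _ := MeasurableSet.univ
  add_mem_iff x y s := by simp
  zero_eq s := by simp

lemma countInd_insertNth_of_lt {n : ℕ} (i : Fin (n + 1)) {t u : ℝ} (hu : t < u) (m : ℕ)
    (D : Set ℝ) (y : Fin n → ℝ) :
    countInd t m D (i.insertNth u y : Fin (n + 1) → ℝ) = countInd t m D y := by
  rw [countInd, countLE_insertNth, sumLE_insertNth, if_neg (not_le.2 hu), if_neg (not_le.2 hu),
    zero_add, zero_add, countInd]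

lemma countInd_insertNth_of_le {n : ℕ} {lam : ℝ} {D : ℝ → Set ℝ} {F : ℕ → ℝ → ℝ}
    (hF : IsShiftFamily lam D F) (i : Fin (n + 1)) {t u : ℝ} (hu : u ≤ t) (m : ℕ) (s : ℝ)
    (y : Fin n → ℝ) :
    countInd t m (D s) (i.insertNth u y : Fin (n + 1) → ℝ)
      = if m = 0 then 0 else countInd t (m - 1) (D (s - u)) y := by
  rw [countInd, countLE_insertNth, sumLE_insertNth, if_pos hu, if_pos hu, hF.add_mem_iff]
  rcases m with _ | m
  · rw [if_neg (by omega), if_pos rfl]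
  · rw [if_neg (Nat.succ_ne_zero m), Nat.add_sub_cancel, countInd]
    by_cases h : sumLE t y ∈ D (s - u) <;> simp [h, add_comm 1]

/-- Induction on `n`, splitting off one coordinate `u`. If `u > t`, it contributes the factor `e^{-λ
t}` and leaves `m` and `s` alone; if `u ≤ t`, it lowers `m` by one and `s` by `u`, and
`setIntegral_truncSum` applies. Pascal's rule for `n.choose m` adds the two cases. -/
theorem integral_countInd {lam t : ℝ} (hl : 0 < lam) (ht : 0 ≤ t) {D : ℝ → Set ℝ}
    {F : ℕ → ℝ → ℝ} (hF : IsShiftFamily lam D F) (n m : ℕ) (s : ℝ) :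
    ∫ x, countInd t m (D s) x ∂(sampleLaw n lam)
      = (n.choose m : ℝ) * Real.exp (-(lam * (((n : ℝ) - m) * t))) * truncSum F lam t m s := by
  have := isProbabilityMeasure_expMeasure hl
  induction n generalizing m s with
  | zero =>
    have := isProbabilityMeasure_sampleLaw hl 0
    have h : ∀ x : Fin 0 → ℝ, countInd t m (D s) x = if m = 0 then F 0 s else 0 := by
      intro x
      simp only [countInd, countLE, sumLE, hF.zero_eq, Finset.univ_eq_empty, Finset.sum_empty]
      by_cases h1 : m = 0 <;> by_cases h2 : (0 : ℝ) ∈ D s <;> simp [h1, h2, eq_comm (a := 0)]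
    simp only [h, integral_const, probReal_univ, one_smul]
    cases m with
    | zero => simp [truncSum]
    | succ m => simp
  | succ n ih =>
    have hpn := isProbabilityMeasure_sampleLaw hl n
    rw [integral_sampleLaw_succ hl 0 (integrable_countInd hl t m (hF.measurableSet s))]
    set g : ℝ → ℝ := fun u => ∫ y, countInd t m (D s) ((0 : Fin (n + 1)).insertNth u y)
      ∂(sampleLaw n lam) with hg
    have hgt : ∀ u ∈ Set.Ioi t, g u = ∫ y, countInd t m (D s) y ∂(sampleLaw n lam) := by
      intro u hu
      exact integral_congr_ae (.of_forall fun y => countInd_insertNth_of_lt 0 hu m (D s) y)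
    have hle : ∀ u ∈ Set.Iic t, g u = (if m = 0 then 0 else
        ∫ y, countInd t (m - 1) (D (s - u)) y ∂(sampleLaw n lam)) := by
      intro u hu
      have := integral_congr_ae (μ := sampleLaw n lam)
        (.of_forall fun y => countInd_insertNth_of_le hF 0 (Set.mem_Iic.1 hu) m s y)
      refine this.trans ?_
      split_ifs <;> simp
    have hgm : Integrable g (expMeasure lam) := by
      refine Integrable.of_bound ?_ 1 (.of_forall fun u => ?_)
      · have hm : Measurable fun p : ℝ × (Fin n → ℝ) =>
            countInd t m (D s) ((0 : Fin (n + 1)).insertNth p.1 p.2 : Fin (n + 1) → ℝ) :=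
          (measurable_countInd t m (hF.measurableSet s)).comp
            (MeasurableEquiv.piFinSuccAbove (fun _ => ℝ) 0).symm.measurable
        exact hm.stronglyMeasurable.integral_prod_right'.aestronglyMeasurable
      · refine (norm_integral_le_integral_norm _).trans ?_
        calc ∫ y, ‖countInd t m (D s) ((0 : Fin (n + 1)).insertNth u y : Fin (n + 1) → ℝ)‖
              ∂(sampleLaw n lam) ≤ ∫ _, 1 ∂(sampleLaw n lam) :=
              integral_mono_of_nonneg (.of_forall fun _ => norm_nonneg _) (integrable_const _)
                (.of_forall fun y => abs_countInd_le t m (D s) _)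
          _ = 1 := by simp
    rw [← integral_add_compl measurableSet_Iic hgm (s := Set.Iic t), Set.compl_Iic,
      setIntegral_congr_fun measurableSet_Ioi hgt, setIntegral_congr_fun measurableSet_Iic hle,
      setIntegral_Ioi_expMeasure hl ht, ih]
    have he : Real.exp (-(lam * t)) * Real.exp (-(lam * (((n : ℝ) - m) * t)))
        = Real.exp (-(lam * (((n + 1 : ℕ) - (m : ℝ)) * t))) := by
      rw [← Real.exp_add]
      push_cast
      ring_nf
    simp only [integral_const, probReal_univ, one_smul]
    rw [← he]
    rcases m with _ | m
    · simp
      ring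
    -- Both cases carry the same survival factor: of `n + 1` lifetimes, `n - m` exceed `t`.
    · have he' : Real.exp (-(lam * t)) * Real.exp (-(lam * (((n : ℝ) - (m + 1 : ℕ)) * t)))
          = Real.exp (-(lam * (((n : ℝ) - m) * t))) := by
        rw [← Real.exp_add]
        push_cast
        ring_nf
      rw [he']
      simp only [Nat.add_eq_zero_iff, one_ne_zero, and_false, if_false, Nat.add_sub_cancel, ih,
        integral_const_mul]
      rw [setIntegral_truncSum hl ht hF.toIsExpFamily, Nat.choose_succ_succ, ← he']
      push_cast
      ring

lemma ae_pos_sampleLaw {lam : ℝ} (hl : 0 < lam) (n : ℕ) :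
    ∀ᵐ x ∂(sampleLaw n lam), ∀ i, 0 < x i := by
  have := isProbabilityMeasure_expMeasure hl
  rw [ae_all_iff]
  intro i
  exact (measurePreserving_eval (fun _ : Fin n => expMeasure lam) i).quasiMeasurePreserving.ae
    (ae_pos_gammaMeasure 1 lam)

/-- A tie between two given coordinates is a null event by Fubini, as the exponential law has no
atoms. -/
lemma ae_injective_sampleLaw {lam : ℝ} (hl : 0 < lam) (n : ℕ) :
    ∀ᵐ x ∂(sampleLaw n lam), Function.Injective x := by
  have := isProbabilityMeasure_expMeasure hl
  have h : ∀ᵐ x ∂(sampleLaw n lam), ∀ i j : Fin n, i ≠ j → x i ≠ x j := by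
    simp only [ae_all_iff]
    intro i j hij
    cases n with
    | zero => exact i.elim0
    | succ n =>
      obtain ⟨j, rfl⟩ := Fin.exists_succAbove_eq hij.symm
      have hpn := isProbabilityMeasure_sampleLaw hl n
      have hmp := measurePreserving_piFinSuccAbove (fun _ : Fin (n + 1) => expMeasure lam) i
      have hp : ∀ᵐ p ∂((expMeasure lam).prod (sampleLaw n lam)), p.1 ≠ p.2 j := by
        have hms : MeasurableSet {p : ℝ × (Fin n → ℝ) | p.1 = p.2 j}ᶜ :=
          (measurableSet_eq_fun measurable_fst (by fun_prop)).compl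
        refine (Measure.ae_prod_iff_ae_ae hms).2 ?_
        refine .of_forall fun u => ?_
        filter_upwards [Measure.ae_eval_ne (μ := fun _ : Fin n => expMeasure lam) j u] with y hy
        exact hy.symm
      exact hmp.quasiMeasurePreserving.ae hp
  filter_upwards [h] with x hx i j hij
  by_contra hne
  exact hx i j hne hij

/-- The joint law of an order statistic and of the sum of the order statistics up to it. -/
theorem integral_orderStat {lam : ℝ} (hl : 0 < lam) {n r : ℕ} (hrn : r ≤ n) {f : ℝ → ℝ → ℝ}
    (hf : Measurable (Function.uncurry f)) (K : ℝ) (hK : ∀ u v, |f u v| ≤ K) :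
    ∫ x : Fin (n + 1) → ℝ, f (orderStat x (r + 1)) (∑ i ∈ Finset.Icc 1 (r + 1), orderStat x i)
        ∂(sampleLaw (n + 1) lam)
      = (n + 1) * ∫ t, ∫ y : Fin n → ℝ,
        (if countLE t y = r then f t (t + sumLE t y) else 0) ∂(sampleLaw n lam)
          ∂(expMeasure lam) := by
  have h1 : (fun x : Fin (n + 1) → ℝ =>
        f (orderStat x (r + 1)) (∑ i ∈ Finset.Icc 1 (r + 1), orderStat x i))
      =ᵐ[sampleLaw (n + 1) lam] fun x => ∑ i, if countLE (x i) x = r + 1 then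
        f (x i) (sumLE (x i) x) else 0 := by
    filter_upwards [ae_injective_sampleLaw hl (n + 1)] with x hx
    exact sum_ite_countLE hx (by omega) (by omega) f
  have hK0 : 0 ≤ K := (abs_nonneg _).trans (hK 0 0)
  have hc : ∀ i : Fin (n + 1), Measurable fun x : Fin (n + 1) → ℝ => countLE (x i) x := by
    intro i
    unfold countLE
    refine Finset.measurable_sum _ fun j _ => ?_
    exact Measurable.ite (measurableSet_le (measurable_pi_apply j) (measurable_pi_apply i))
      measurable_const measurable_const
  have hs : ∀ i : Fin (n + 1), Measurable fun x : Fin (n + 1) → ℝ => sumLE (x i) x := by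
    intro i
    unfold sumLE
    refine Finset.measurable_sum _ fun j _ => ?_
    exact Measurable.ite (measurableSet_le (measurable_pi_apply j) (measurable_pi_apply i))
      (measurable_pi_apply j) measurable_const
  have hint : ∀ i : Fin (n + 1), Integrable (fun x : Fin (n + 1) → ℝ =>
      if countLE (x i) x = r + 1 then f (x i) (sumLE (x i) x) else 0)
      (sampleLaw (n + 1) lam) := by
    intro i
    refine integrable_of_bounded hl ?_ K fun x => ?_
    · exact Measurable.ite (measurableSet_eq_fun (hc i) measurable_const)
        (hf.comp ((measurable_pi_apply i).prodMk (hs i))) measurable_const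
    · split_ifs
      · exact hK _ _
      · simpa using hK0
  rw [integral_congr_ae h1, integral_finsetSum _ fun i _ => hint i]
  -- All `n + 1` indices contribute equally. The coordinate split off counts itself, so exactly `r`
  -- of the other `n` must be at most `t`.
  have h2 : ∀ i : Fin (n + 1), ∫ x : Fin (n + 1) → ℝ,
      (if countLE (x i) x = r + 1 then f (x i) (sumLE (x i) x) else 0) ∂(sampleLaw (n + 1) lam)
      = ∫ t, ∫ y : Fin n → ℝ, (if countLE t y = r then f t (t + sumLE t y) else 0)
        ∂(sampleLaw n lam) ∂(expMeasure lam) := by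
    intro i
    rw [integral_sampleLaw_succ hl i (hint i)]
    simp [countLE_insertNth, sumLE_insertNth, add_comm 1]
  simp [h2]

/-! ### Expectations under the gamma prior -/

/-- `f` is integrable with integral `v`. -/
def HasMean (μ : Measure ℝ) (f : ℝ → ℝ) (v : ℝ) : Prop :=
  Integrable f μ ∧ ∫ x, f x ∂μ = v

namespace HasMean

variable {μ : Measure ℝ} {f g : ℝ → ℝ} {u v : ℝ}

lemma add (hf : HasMean μ f u) (hg : HasMean μ g v) : HasMean μ (fun x => f x + g x) (u + v) :=
  ⟨hf.1.add hg.1, by rw [integral_add hf.1 hg.1, hf.2, hg.2]⟩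

lemma sub (hf : HasMean μ f u) (hg : HasMean μ g v) : HasMean μ (fun x => f x - g x) (u - v) :=
  ⟨hf.1.sub hg.1, by rw [integral_sub hf.1 hg.1, hf.2, hg.2]⟩

lemma const_mul (c : ℝ) (hf : HasMean μ f u) : HasMean μ (fun x => c * f x) (c * u) :=
  ⟨hf.1.const_mul c, by rw [integral_const_mul, hf.2]⟩

lemma sum {ι : Type*} (s : Finset ι) {f : ι → ℝ → ℝ} {u : ι → ℝ}
    (hf : ∀ i ∈ s, HasMean μ (f i) (u i)) :
    HasMean μ (fun x => ∑ i ∈ s, f i x) (∑ i ∈ s, u i) :=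
  ⟨integrable_finsetSum _ fun i hi => (hf i hi).1, by
    rw [integral_finsetSum _ fun i hi => (hf i hi).1]
    exact Finset.sum_congr rfl fun i hi => (hf i hi).2⟩

lemma congr_ae (hf : HasMean μ f u) (h : f =ᵐ[μ] g) : HasMean μ g u :=
  ⟨hf.1.congr h, by rw [← integral_congr_ae h, hf.2]⟩

lemma congr_fun (hf : HasMean μ f u) (h : ∀ x, f x = g x) : HasMean μ g u :=
  hf.congr_ae (.of_forall h)

end HasMean

/-- The factor `λ^p e^{-λ c}` turns the gamma density into the kernel of the gamma law of shape `a +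
p` and rate `b + c`. -/
lemma hasMean_pow_mul_exp {a b c : ℝ} (ha : 0 < a) (hb : 0 < b) (hc : 0 ≤ c) (p : ℕ) :
    HasMean (gammaMeasure a b) (fun lam => lam ^ p * Real.exp (-(lam * c)))
      (b ^ a / Real.Gamma a * (Real.Gamma (a + p) / (b + c) ^ (a + p))) := by
  have hap : 0 < a + p := by positivity
  have hbc : 0 < b + c := by positivity
  have h1 : Set.EqOn (fun x : ℝ => b ^ a / Real.Gamma a * x ^ (a - 1) * Real.exp (-(b * x))
        * (x ^ p * Real.exp (-(x * c))))
      (fun x => b ^ a / Real.Gamma a * (x ^ (a + p - 1) * Real.exp (-((b + c) * x))))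
      (Set.Ioi 0) := by
    intro x hx
    have hx' : (0 : ℝ) < x := hx
    have h2 : Real.exp (-((b + c) * x)) = Real.exp (-(b * x)) * Real.exp (-(x * c)) := by
      rw [← Real.exp_add]; ring_nf
    have h3 : x ^ (a + p - 1) = x ^ (a - 1) * x ^ p := by
      rw [← Real.rpow_natCast, ← Real.rpow_add hx']; ring_nf
    simp only [h2, h3]
    ring
  have h4 := Real.integral_rpow_mul_exp_neg_mul_Ioi hap hbc
  have h5 : (1 / (b + c)) ^ (a + p) * Real.Gamma (a + p)
      = Real.Gamma (a + p) / (b + c) ^ (a + p) := by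
    rw [Real.div_rpow zero_le_one hbc.le, Real.one_rpow]
    ring
  rw [h5] at h4
  have h6 : Real.Gamma (a + p) / (b + c) ^ (a + p) ≠ 0 :=
    (div_pos (Real.Gamma_pos_of_pos hap) (Real.rpow_pos_of_pos hbc _)).ne'
  constructor
  · rw [integrable_gammaMeasure ha hb, integrableOn_congr_fun h1 measurableSet_Ioi]
    refine Integrable.const_mul ?_ _
    -- A non-integrable function has integral `0` by convention, so the nonzero value of the gamma
    -- integral gives integrability.
    refine Integrable.of_integral_ne_zero ?_
    rw [h4]
    exact h6
  · rw [integral_gammaMeasure ha hb, setIntegral_congr_fun measurableSet_Ioi h1,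
      integral_const_mul, h4]

lemma hasMean_exp {a b c : ℝ} (ha : 0 < a) (hb : 0 < b) (hc : 0 ≤ c) :
    HasMean (gammaMeasure a b) (fun lam => Real.exp (-(lam * c))) (b ^ a / (b + c) ^ a) := by
  have h := (hasMean_pow_mul_exp ha hb hc 0).congr_fun (g := fun lam => Real.exp (-(lam * c)))
    (by simp)
  have hG := (Real.Gamma_pos_of_pos ha).ne'
  have h2 : b ^ a / (b + c) ^ a
      = b ^ a / Real.Gamma a * (Real.Gamma (a + (0 : ℕ)) / (b + c) ^ (a + (0 : ℕ))) := by
    simp only [Nat.cast_zero, add_zero]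
    field_simp
  rwa [h2]

lemma integrable_pow_gammaMeasure {a b : ℝ} (ha : 0 < a) (hb : 0 < b) (p : ℕ) :
    Integrable (fun lam => lam ^ p) (gammaMeasure a b) := by
  simpa using (hasMean_pow_mul_exp ha hb le_rfl p).1

/-! ### The incomplete beta function -/

lemma integral_pow_mul_one_sub_rpow_zero {x β : ℝ} (hx : 0 ≤ x) (hx1 : x < 1) (hβ : 0 < β) :
    ∫ u in 0..x, (1 - u) ^ (β - 1) = (1 - (1 - x) ^ β) / β := by
  have h : ∀ u ∈ Set.uIcc 0 x, HasDerivAt (fun u : ℝ => -(1 - u) ^ β / β) ((1 - u) ^ (β - 1)) u := by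
    intro u hu
    rw [Set.uIcc_of_le hx] at hu
    have hu1 : 1 - u ≠ 0 := by linarith [hu.2]
    convert! ((((hasDerivAt_id u).const_sub 1).rpow_const (p := β) (.inl hu1)).neg).div_const β
      using 1
    simp only [id]
    field_simp
  rw [intervalIntegral.integral_eq_sub_of_hasDerivAt h]
  · simp
    ring
  · refine ContinuousOn.intervalIntegrable fun u hu => ?_
    rw [Set.uIcc_of_le hx] at hu
    exact (ContinuousAt.rpow_const (by fun_prop)
      (.inl (by linarith [hu.2]))).continuousWithinAt

lemma intervalIntegrable_pow_mul_one_sub_rpow {x : ℝ} (hx : 0 ≤ x) (hx1 : x < 1) (q : ℝ) (m : ℕ) :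
    IntervalIntegrable (fun u : ℝ => u ^ m * (1 - u) ^ q) volume 0 x := by
  refine ContinuousOn.intervalIntegrable fun u hu => ?_
  rw [Set.uIcc_of_le hx] at hu
  exact (ContinuousAt.mul (by fun_prop) (ContinuousAt.rpow_const (by fun_prop)
    (.inl (by linarith [hu.2])))).continuousWithinAt

/-- Integration by parts: this is the integral of the derivative of `u^(m+1) (1-u)^β`. It drives the
recursion of the incomplete beta function in its first parameter. -/
lemma integral_pow_mul_one_sub_rpow_succ {x β : ℝ} (hx : 0 ≤ x) (hx1 : x < 1) (m : ℕ) :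
    (m + 1) * ∫ u in 0..x, u ^ m * (1 - u) ^ (β - 1)
      = x ^ (m + 1) * (1 - x) ^ β
        + (m + 1 + β) * ∫ u in 0..x, u ^ (m + 1) * (1 - u) ^ (β - 1) := by
  have h : ∀ u ∈ Set.uIcc 0 x, HasDerivAt (fun u : ℝ => u ^ (m + 1) * (1 - u) ^ β)
      ((m + 1) * (u ^ m * (1 - u) ^ (β - 1))
        - (m + 1 + β) * (u ^ (m + 1) * (1 - u) ^ (β - 1))) u := by
    intro u hu
    rw [Set.uIcc_of_le hx] at hu
    have hu1 : 0 < 1 - u := by linarith [hu.2]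
    convert! (hasDerivAt_pow (m + 1) u).mul
      (((hasDerivAt_id u).const_sub 1).rpow_const (p := β) (.inl hu1.ne')) using 1
    have : (1 - u) ^ β = (1 - u) ^ (β - 1) * (1 - u) := by
      rw [← Real.rpow_add_one hu1.ne']; ring_nf
    simp only [id, this]
    push_cast
    ring
  have h1 := intervalIntegrable_pow_mul_one_sub_rpow hx hx1 (β - 1) m
  have h2 := intervalIntegrable_pow_mul_one_sub_rpow hx hx1 (β - 1) (m + 1)
  have h3 := intervalIntegral.integral_eq_sub_of_hasDerivAt h ((h1.const_mul _).sub (h2.const_mul _))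
  rw [intervalIntegral.integral_sub (h1.const_mul _) (h2.const_mul _),
    intervalIntegral.integral_const_mul, intervalIntegral.integral_const_mul] at h3
  simp only [ne_eq, Nat.add_eq_zero_iff, one_ne_zero, and_false, not_false_eq_true, zero_pow,
    zero_mul, sub_zero] at h3
  linarith

lemma regIncBeta_natCast_succ {x : ℝ} (hx : 0 ≤ x) (β : ℝ) (m : ℕ) :
    regIncBeta x (m + 1 : ℕ) β
      = (∫ u in 0..x, u ^ m * (1 - u) ^ (β - 1)) / ProbabilityTheory.beta (m + 1 : ℕ) β := by
  rw [regIncBeta, intervalIntegral.integral_of_le hx]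
  simp

/-- For an integer first parameter the incomplete beta function is a negative binomial tail. -/
theorem regIncBeta_natCast {x β : ℝ} (hx : 0 ≤ x) (hx1 : x < 1) (hβ : 0 < β) (m : ℕ) :
    regIncBeta x (m + 1 : ℕ) β = 1 - ∑ k ∈ Finset.range (m + 1),
      Real.Gamma (β + k) / (k.factorial * Real.Gamma β) * x ^ k * (1 - x) ^ β := by
  have hG := (Real.Gamma_pos_of_pos hβ).ne'
  induction m with
  | zero =>
    rw [regIncBeta_natCast_succ hx]
    simp only [pow_zero, one_mul, integral_pow_mul_one_sub_rpow_zero hx hx1 hβ,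
      ProbabilityTheory.beta]
    simp only [zero_add, Nat.cast_one, Real.Gamma_one, one_mul, add_comm 1 β,
      Real.Gamma_add_one hβ.ne', Finset.sum_range_one, Nat.cast_zero, add_zero, pow_zero, mul_one,
      Nat.factorial_zero]
    field_simp
  | succ m ih =>
    rw [Finset.sum_range_succ, ← sub_sub, ← ih, regIncBeta_natCast_succ hx,
      regIncBeta_natCast_succ hx]
    -- The boundary term of this recursion, once normalized, is the new negative binomial weight.
    have h := integral_pow_mul_one_sub_rpow_succ (β := β) hx hx1 m
    have hm1 : (0 : ℝ) < (m : ℝ) + 1 := by positivity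
    have hmb : (0 : ℝ) < (m : ℝ) + 1 + β := by positivity
    have hG2 := (Real.Gamma_pos_of_pos hmb).ne'
    have hf : (m.factorial : ℝ) ≠ 0 := by positivity
    simp only [ProbabilityTheory.beta]
    push_cast
    rw [show (m : ℝ) + 1 + 1 + β = (m + 1 + β) + 1 by ring, Real.Gamma_add_one hmb.ne',
      Real.Gamma_add_one hm1.ne', Real.Gamma_nat_eq_factorial, Nat.factorial_succ,
      show β + ((m : ℝ) + 1) = m + 1 + β by ring]
    have h7 : ∫ u in 0..x, u ^ m * (1 - u) ^ (β - 1) = (x ^ (m + 1) * (1 - x) ^ β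
        + (m + 1 + β) * ∫ u in 0..x, u ^ (m + 1) * (1 - u) ^ (β - 1)) / (m + 1) := by
      rw [← h]; field_simp
    rw [h7]
    push_cast
    field_simp
    ring

/-- Mixing the Poisson weights of `sumCDF` over the gamma law gives negative binomial weights with
parameter `u / (b + c + u)`, which sum to the complement of an incomplete beta function. -/
theorem hasMean_sumCDF {a b c : ℝ} (ha : 0 < a) (hb : 0 < b) (hc : 0 ≤ c) (p : ℕ) {m : ℕ}
    (hm : 1 ≤ m) {u : ℝ} (hu : 0 < b + c + u) :
    HasMean (gammaMeasure a b)
      (fun lam => lam ^ p * (Real.exp (-(lam * c)) * sumCDF m lam u))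
      (b ^ a / Real.Gamma a * (Real.Gamma (a + p) / (b + c) ^ (a + p)
        * regIncBeta (u / (b + c + u)) m (a + p))) := by
  have hbc : 0 < b + c := by positivity
  by_cases hu0 : 0 ≤ u
  · obtain ⟨m, rfl⟩ := Nat.exists_eq_add_of_le' hm
    have hap : 0 < a + p := by positivity
    have h1 := (hasMean_pow_mul_exp ha hb hc p).sub (HasMean.sum (Finset.range (m + 1))
      fun k _ => (hasMean_pow_mul_exp ha hb (add_nonneg hc hu0) (p + k)).const_mul
        (u ^ k / k.factorial))
    have hS : 1 - u / (b + c + u) = (b + c) / (b + c + u) := by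
      field_simp
      ring
    have h2 := h1.congr_fun (g := fun lam =>
        lam ^ p * (Real.exp (-(lam * c)) * sumCDF (m + 1) lam u)) (fun lam => by
      rw [sumCDF, if_pos hu0]
      have : Real.exp (-(lam * (c + u))) = Real.exp (-(lam * c)) * Real.exp (-(lam * u)) := by
        rw [← Real.exp_add]; ring_nf
      simp only [this, mul_sub, mul_one, Finset.sum_mul, Finset.mul_sum]
      congr 1
      refine Finset.sum_congr rfl fun k _ => ?_
      rw [pow_add, mul_pow]
      ring)
    refine ⟨h2.1, h2.2.trans ?_⟩
    rw [regIncBeta_natCast (by positivity) (by rw [div_lt_one hu]; linarith) hap, hS, mul_sub,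
      mul_sub, mul_one]
    congr 1
    simp only [Finset.mul_sum]
    refine Finset.sum_congr rfl fun k _ => ?_
    rw [Real.div_rpow hbc.le hu.le, div_pow, ← add_assoc b c u]
    push_cast
    rw [← add_assoc, Real.rpow_add_natCast hu.ne']
    have hG := (Real.Gamma_pos_of_pos hap).ne'
    have hG2 := (Real.Gamma_pos_of_pos ha).ne'
    have h3 := (Real.rpow_pos_of_pos hu (a + p)).ne'
    have h4 := (Real.rpow_pos_of_pos hbc (a + p)).ne'
    field_simp
  -- For `u < 0` both sides vanish: the beta integral runs over an empty interval.
  · have hS : u / (b + c + u) ≤ 0 := div_nonpos_of_nonpos_of_nonneg (by linarith) hu.le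
    constructor <;> simp [sumCDF, hu0, regIncBeta, hS]

/-- By Fubini the gamma integral is done first, leaving a rational-power integrand in `t`.
Integrating it by parts needs a primitive of `(b + c t)^(-a)`, hence `a ≠ 1`. -/
lemma hasMean_truncated_moment {a b c τ : ℝ} (ha : 0 < a) (ha1 : a ≠ 1) (hb : 0 < b) (hc : 0 < c)
    (hτ : 0 ≤ τ) :
    HasMean (gammaMeasure a b) (fun lam => ∫ t in 0..τ, lam * t * Real.exp (-(lam * (c * t))))
      (b / (c ^ 2 * (a - 1)) - τ * b ^ a / (c * (c * τ + b) ^ a)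
        - b ^ a / (c ^ 2 * (a - 1) * (c * τ + b) ^ (a - 1))) := by
  have hpm := isProbabilityMeasure_gammaMeasure ha hb
  have h0 : Integrable (Function.uncurry fun lam t : ℝ => lam * t * Real.exp (-(lam * (c * t))))
      ((gammaMeasure a b).prod (volume.restrict (Set.Ioc 0 τ))) := by
    -- The exponential factor is at most `1` almost everywhere, so the product `λ t` dominates.
    have h1 : Integrable (fun z : ℝ × ℝ => z.1 * z.2)
        ((gammaMeasure a b).prod (volume.restrict (Set.Ioc 0 τ))) := by
      refine Integrable.mul_prod (f := fun x : ℝ => x) (g := fun x : ℝ => x) ?_ ?_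
      · simpa using integrable_pow_gammaMeasure ha hb 1
      · exact (continuous_id.integrableOn_Icc).mono_set Set.Ioc_subset_Icc_self
    refine h1.mono (by fun_prop) ?_
    have h2 : ∀ᵐ z ∂((gammaMeasure a b).prod (volume.restrict (Set.Ioc 0 τ))), 0 < z.1 :=
      Measure.quasiMeasurePreserving_fst.ae (ae_pos_gammaMeasure a b)
    have h3 : ∀ᵐ z ∂((gammaMeasure a b).prod (volume.restrict (Set.Ioc 0 τ))),
        z.2 ∈ Set.Ioc 0 τ :=
      Measure.quasiMeasurePreserving_snd.ae (ae_restrict_mem measurableSet_Ioc)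
    filter_upwards [h2, h3] with z hz1 hz2
    have hz2' := hz2.1
    simp only [Function.uncurry, norm_mul]
    refine mul_le_of_le_one_right (by positivity) ?_
    rw [Real.norm_of_nonneg (Real.exp_pos _).le, Real.exp_le_one_iff]
    have : 0 ≤ z.1 * (c * z.2) := by positivity
    linarith
  simp only [intervalIntegral.integral_of_le hτ]
  refine ⟨h0.integral_prod_left, ?_⟩
  rw [integral_integral_swap h0]
  have h4 : ∀ t ∈ Set.Ioc 0 τ, ∫ lam, lam * t * Real.exp (-(lam * (c * t))) ∂(gammaMeasure a b)
      = t * (a * b ^ a / (b + c * t) ^ (a + 1)) := by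
    intro t ht
    have ht0 := ht.1
    have h5 := (hasMean_pow_mul_exp ha hb (mul_pos hc ht0).le 1).const_mul t
    have h6 := h5.2
    simp only [pow_one, Nat.cast_one, Real.Gamma_add_one ha.ne'] at h6
    have hG := (Real.Gamma_pos_of_pos ha).ne'
    rw [show t * (a * b ^ a / (b + c * t) ^ (a + 1)) = t * (b ^ a / Real.Gamma a *
      (a * Real.Gamma a / (b + c * t) ^ (a + 1))) by field_simp, ← h6]
    congr 1 with lam
    ring
  rw [setIntegral_congr_fun measurableSet_Ioc h4, ← intervalIntegral.integral_of_le hτ]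
  have ha1' : a - 1 ≠ 0 := sub_ne_zero.2 ha1
  have h7 : ∀ t ∈ Set.uIcc 0 τ, HasDerivAt (fun t => - (b ^ a / c) * (t * (b + c * t) ^ (-a))
      - b ^ a / (c ^ 2 * (a - 1)) * (b + c * t) ^ (1 - a))
      (t * (a * b ^ a / (b + c * t) ^ (a + 1))) t := by
    intro t ht
    rw [Set.uIcc_of_le hτ] at ht
    have ht0 := ht.1
    have hp : 0 < b + c * t := by positivity
    have h8 : HasDerivAt (fun t => b + c * t) c t := by
      simpa using ((hasDerivAt_id t).const_mul c).const_add b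
    convert! (((hasDerivAt_id t).mul (h8.rpow_const (p := -a) (.inl hp.ne'))).const_mul
      (-(b ^ a / c))).sub ((h8.rpow_const (p := 1 - a) (.inl hp.ne')).const_mul
        (b ^ a / (c ^ 2 * (a - 1)))) using 1
    have e1 : (b + c * t) ^ (-a) = (b + c * t) / (b + c * t) ^ (a + 1) := by
      rw [Real.rpow_neg hp.le, Real.rpow_add_one hp.ne']
      field_simp
    have e2 : (b + c * t) ^ (-a - 1) = 1 / (b + c * t) ^ (a + 1) := by
      rw [show -a - 1 = -(a + 1) by ring, Real.rpow_neg hp.le, one_div]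
    have e3 : (b + c * t) ^ (1 - a - 1) = (b + c * t) / (b + c * t) ^ (a + 1) := by
      rw [show 1 - a - 1 = -a by ring, e1]
    simp only [id, e1, e2, e3]
    have h9 := (Real.rpow_pos_of_pos hp (a + 1)).ne'
    field_simp
    ring
  rw [intervalIntegral.integral_eq_sub_of_hasDerivAt h7]
  · have hp : 0 < c * τ + b := by positivity
    simp only [mul_zero, add_zero, zero_mul]
    rw [show b + c * τ = c * τ + b by ring, Real.rpow_neg hp.le,
      show (1 : ℝ) - a = -(a - 1) by ring, Real.rpow_neg hp.le, Real.rpow_neg hb.le,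
      show b ^ a = b ^ (a - 1) * b by rw [← Real.rpow_add_one hb.ne']; ring_nf]
    have := (Real.rpow_pos_of_pos hb (a - 1)).ne'
    have := (Real.rpow_pos_of_pos hp (a - 1)).ne'
    have := (Real.rpow_pos_of_pos hp a).ne'
    field_simp
    ring
  · refine ContinuousOn.intervalIntegrable fun t ht => ?_
    rw [Set.uIcc_of_le hτ] at ht
    have ht0 := ht.1
    have hp : 0 < b + c * t := by positivity
    refine ContinuousAt.continuousWithinAt (ContinuousAt.mul continuousAt_id
      (ContinuousAt.div continuousAt_const (ContinuousAt.rpow_const (by fun_prop) (.inl hp.ne'))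
        (Real.rpow_pos_of_pos hp _).ne'))

/-! ### Expectations for a given failure rate -/

lemma integral_countLE_eq {lam t : ℝ} (hl : 0 < lam) (ht : 0 ≤ t) (n m : ℕ) :
    ∫ x : Fin n → ℝ, (if countLE t x = m then (1 : ℝ) else 0) ∂(sampleLaw n lam)
      = ∑ j ∈ Finset.range (m + 1), (n.choose m : ℝ) * (m.choose j : ℝ) * (-1) ^ j
        * Real.exp (-(lam * (((n : ℝ) - m + j) * t))) := by
  have h := integral_countInd hl ht (isShiftFamily_univ hl) n m 0
  have h1 : ∀ x : Fin n → ℝ, countInd t m Set.univ x = if countLE t x = m then (1 : ℝ) else 0 := by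
    intro x
    simp [countInd]
  simp only [h1] at h
  rw [h, truncSum, Finset.mul_sum]
  refine Finset.sum_congr rfl fun j _ => ?_
  rw [show -(lam * (((n : ℝ) - m + j) * t)) = -(lam * ((n - m) * t)) + -(lam * (j * t)) by ring,
    Real.exp_add]
  ring

lemma integral_comp_countLE {lam t : ℝ} (hl : 0 < lam) (ht : 0 ≤ t) (n : ℕ) (g : ℕ → ℝ) :
    ∫ x : Fin n → ℝ, g (countLE t x) ∂(sampleLaw n lam)
      = ∑ m ∈ Finset.range (n + 1), ∑ j ∈ Finset.range (m + 1),
        g m * (n.choose m : ℝ) * (m.choose j : ℝ) * (-1) ^ j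
          * Real.exp (-(lam * (((n : ℝ) - m + j) * t))) := by
  have h : ∀ x : Fin n → ℝ, g (countLE t x)
      = ∑ m ∈ Finset.range (n + 1), g m * if countLE t x = m then (1 : ℝ) else 0 := by
    intro x
    simp [Nat.lt_succ_of_le (countLE_le t x)]
  simp only [h]
  rw [integral_finsetSum]
  · refine Finset.sum_congr rfl fun m _ => ?_
    rw [integral_const_mul, integral_countLE_eq hl ht, Finset.mul_sum]
    refine Finset.sum_congr rfl fun j _ => ?_
    ring
  · intro m _
    refine Integrable.const_mul (integrable_of_bounded hl ?_ 1 fun x => ?_) _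
    · exact Measurable.ite (measurableSet_eq_fun (measurable_countLE t) measurable_const)
        measurable_const measurable_const
    · split_ifs <;> simp

lemma ae_pos_expMeasure (lam : ℝ) : ∀ᵐ x ∂(expMeasure lam), 0 < x := ae_pos_gammaMeasure 1 lam

/-- The identity `n * choose (n - 1) r * B(n - r, r + 1) = 1`, with the beta integral expanded. -/
lemma sum_choose_div {n r : ℕ} (hrn : r ≤ n) :
    ((n : ℝ) + 1) * n.choose r * ∑ j ∈ Finset.range (r + 1),
      (r.choose j : ℝ) * (-1) ^ j / ((n : ℝ) - r + 1 + j) = 1 := by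
  have hpm := isProbabilityMeasure_sampleLaw one_pos (n + 1)
  -- With `f = 1` and rate `1` the law of the order statistic has total mass `1`, and this is the
  -- identity.
  have h := integral_orderStat one_pos hrn (f := fun _ _ => (1 : ℝ)) measurable_const 1 (by simp)
  have h1 : (fun t => ∫ y : Fin n → ℝ, (if countLE t y = r then (1 : ℝ) else 0) ∂(sampleLaw n 1))
      =ᵐ[expMeasure 1] fun t => ∑ j ∈ Finset.range (r + 1),
        (n.choose r : ℝ) * (r.choose j : ℝ) * (-1) ^ j
          * Real.exp (-(t * ((n : ℝ) - r + j))) := by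
    filter_upwards [ae_pos_expMeasure 1] with t ht
    rw [integral_countLE_eq one_pos ht.le]
    refine Finset.sum_congr rfl fun j _ => ?_
    rw [one_mul, mul_comm t]
  have hrn' : (r : ℝ) ≤ n := by exact_mod_cast hrn
  have h2 := HasMean.sum (μ := expMeasure 1) (Finset.range (r + 1)) fun j _ =>
    (hasMean_exp (a := 1) (b := 1) one_pos one_pos
      (add_nonneg (sub_nonneg.2 hrn') (Nat.cast_nonneg (α := ℝ) j))).const_mul
      ((n.choose r : ℝ) * (r.choose j : ℝ) * (-1) ^ j)
  rw [integral_congr_ae h1, h2.2] at h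
  simp only [integral_const, probReal_univ, one_smul, Real.rpow_one] at h
  rw [mul_assoc, Finset.mul_sum _ _ (n.choose r : ℝ)]
  refine Eq.trans ?_ h.symm
  congr 1
  refine Finset.sum_congr rfl fun j _ => ?_
  rw [show 1 + ((n : ℝ) - r + j) = n - r + 1 + j by ring]
  ring

/-- Substituting `y = c t` gives an integral against the exponential law truncated at `c τ`: a full
convolution minus its translate. -/
lemma integral_sumCDF_comp_mul {lam c τ : ℝ} (hl : 0 < lam) (hc : 0 < c) (hτ : 0 ≤ τ) (m : ℕ)
    (s : ℝ) :
    ∫ t in 0..τ, lam * (Real.exp (-(lam * (c * t))) * sumCDF m lam (s - c * t))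
      = (sumCDF (m + 1) lam s - Real.exp (-(lam * (c * τ))) * sumCDF (m + 1) lam (s - c * τ)) / c := by
  have h := intervalIntegral.integral_comp_mul_left
    (fun y => lam * Real.exp (-(lam * y)) * sumCDF m lam (s - y)) hc.ne' (a := 0) (b := τ)
  have hF := isExpFamily_sumCDF hl
  rw [mul_zero, ← setIntegral_Iic_expMeasure hl (mul_nonneg hc.le hτ),
    setIntegral_Iic_expMeasure_eq_sub hl (mul_nonneg hc.le hτ) (hF.integrable hl m s),
    integral_sumCDF_sub hl] at h
  have h3 : ∀ x, s - (x + c * τ) = s - c * τ - x := fun x => by ring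
  simp only [h3, integral_sumCDF_sub hl, smul_eq_mul] at h
  simp only [← mul_assoc] at h ⊢
  rw [h]
  ring

lemma intervalIntegrable_sumCDF_comp_mul {lam c : ℝ} (hl : 0 < lam) (a b : ℝ) (m : ℕ)
    (s : ℝ) : IntervalIntegrable
      (fun t => lam * (Real.exp (-(lam * (c * t))) * sumCDF m lam (s - c * t))) volume a b := by
  refine IntervalIntegrable.const_mul ?_ _
  have h : ContinuousOn (fun t => Real.exp (-(lam * (c * t)))) (Set.uIcc a b) := by fun_prop
  refine IntervalIntegrable.continuousOn_mul ?_ h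
  refine (intervalIntegrable_const (c := (1 : ℝ))).mono_fun
    ((measurable_sumCDF m lam).comp (by fun_prop)).aestronglyMeasurable
    (.of_forall fun t => ?_)
  simpa using norm_sumCDF_le hl m (s - c * t)

/-- The probability that the `(r + 1)`-th failure occurs before `τ` with a total time on test of at
most `s`. -/
theorem integral_orderStat_le {lam τ : ℝ} (hl : 0 < lam) (hτ : 0 ≤ τ) {n r : ℕ} (hrn : r ≤ n)
    (s : ℝ) :
    ∫ x : Fin (n + 1) → ℝ, (if orderStat x (r + 1) ≤ τ ∧
        (∑ i ∈ Finset.Icc 1 (r + 1), orderStat x i) + ((n : ℝ) - r) * orderStat x (r + 1) ≤ s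
        then (1 : ℝ) else 0) ∂(sampleLaw (n + 1) lam)
      = sumCDF (r + 1) lam s - ∑ j ∈ Finset.range (r + 1),
        ((n : ℝ) + 1) * n.choose r * (r.choose j : ℝ) * (-1) ^ j / ((n : ℝ) - r + 1 + j)
          * (Real.exp (-(lam * (((n : ℝ) - r + 1 + j) * τ)))
            * sumCDF (r + 1) lam (s - ((n : ℝ) - r + 1 + j) * τ)) := by
  have hrn' : (0 : ℝ) ≤ n - r := sub_nonneg.2 (by exact_mod_cast hrn)
  have hm1 : MeasurableSet {p : ℝ × ℝ | p.1 ≤ τ} := measurableSet_le (by fun_prop) (by fun_prop)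
  have hm2 : MeasurableSet {p : ℝ × ℝ | p.2 + ((n : ℝ) - r) * p.1 ≤ s} :=
    measurableSet_le (by fun_prop) (by fun_prop)
  have hf : Measurable (Function.uncurry fun u v : ℝ =>
      if u ≤ τ ∧ v + ((n : ℝ) - r) * u ≤ s then (1 : ℝ) else 0) :=
    Measurable.ite (hm1.inter hm2) measurable_const measurable_const
  rw [integral_orderStat hl hrn hf 1 fun u v => by split_ifs <;> simp]
  have h1 : (fun t => ∫ y : Fin n → ℝ, (if countLE t y = r then
        (if t ≤ τ ∧ t + sumLE t y + ((n : ℝ) - r) * t ≤ s then (1 : ℝ) else 0) else 0)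
          ∂(sampleLaw n lam)) =ᵐ[expMeasure lam] (Set.Iic τ).indicator fun t =>
        (n.choose r : ℝ) * Real.exp (-(lam * (((n : ℝ) - r) * t)))
          * truncSum (fun m => sumCDF m lam) lam t r (s - ((n : ℝ) - r + 1) * t) := by
    filter_upwards [ae_pos_expMeasure lam] with t ht
    by_cases htτ : t ≤ τ
    · rw [Set.indicator_of_mem (show t ∈ Set.Iic τ from htτ),
        ← integral_countInd hl ht.le (isShiftFamily_Iic hl)]
      refine integral_congr_ae (.of_forall fun y => ?_)
      simp only [htτ, true_and, countInd, Set.mem_Iic, ite_and]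
      have : t + sumLE t y + ((n : ℝ) - r) * t ≤ s ↔ sumLE t y ≤ s - ((n : ℝ) - r + 1) * t := by
        constructor <;> intro h <;> linarith
      simp only [this]
    · simp [htτ]
  rw [integral_congr_ae h1, integral_indicator measurableSet_Iic, setIntegral_Iic_expMeasure hl hτ]
  have hc : ∀ j : ℕ, 0 < (n : ℝ) - r + 1 + j := fun j => by positivity
  -- In each term the decay rate and the shift of `s` have the same multiple of `t`, so
  -- `integral_sumCDF_comp_mul` applies.
  have h2 : ∀ t : ℝ, lam * Real.exp (-(lam * t)) * ((n.choose r : ℝ)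
        * Real.exp (-(lam * (((n : ℝ) - r) * t)))
          * truncSum (fun m => sumCDF m lam) lam t r (s - ((n : ℝ) - r + 1) * t))
      = ∑ j ∈ Finset.range (r + 1), (n.choose r : ℝ) * (r.choose j : ℝ) * (-1) ^ j
        * (lam * (Real.exp (-(lam * (((n : ℝ) - r + 1 + j) * t)))
          * sumCDF r lam (s - ((n : ℝ) - r + 1 + j) * t))) := by
    intro t
    rw [truncSum, Finset.mul_sum, Finset.mul_sum]
    refine Finset.sum_congr rfl fun j _ => ?_
    rw [show -(lam * (((n : ℝ) - r + 1 + j) * t))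
        = -(lam * t) + -(lam * (((n : ℝ) - r) * t)) + -(lam * (j * t)) by ring, Real.exp_add,
      Real.exp_add, show s - ((n : ℝ) - r + 1 + j) * t = s - ((n : ℝ) - r + 1) * t - j * t by ring]
    ring
  simp only [h2]
  rw [intervalIntegral.integral_finsetSum
    fun j _ => (intervalIntegrable_sumCDF_comp_mul hl 0 τ r s).const_mul _]
  simp only [intervalIntegral.integral_const_mul, integral_sumCDF_comp_mul hl (hc _) hτ]
  -- The contributions of the endpoint `t = 0` have coefficients summing to `1` and merge into one
  -- term.
  have h3 : sumCDF (r + 1) lam s = (((n : ℝ) + 1) * n.choose r * ∑ j ∈ Finset.range (r + 1),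
      (r.choose j : ℝ) * (-1) ^ j / ((n : ℝ) - r + 1 + j)) * sumCDF (r + 1) lam s := by
    rw [sum_choose_div hrn, one_mul]
  conv_rhs => rw [h3]
  rw [Finset.mul_sum, Finset.mul_sum, Finset.sum_mul, ← Finset.sum_sub_distrib]
  refine Finset.sum_congr rfl fun j _ => ?_
  have := (hc j).ne'
  field_simp

/-- The expectation of the `(r + 1)`-th order statistic on the event that it is at most `τ`. -/
theorem integral_orderStat_truncated {lam τ : ℝ} (hl : 0 < lam) (hτ : 0 ≤ τ) {n r : ℕ}
    (hrn : r ≤ n) :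
    ∫ x : Fin (n + 1) → ℝ, (if 0 ≤ orderStat x (r + 1) ∧ orderStat x (r + 1) ≤ τ
        then orderStat x (r + 1) else 0) ∂(sampleLaw (n + 1) lam)
      = ((n : ℝ) + 1) * n.choose r * ∑ j ∈ Finset.range (r + 1), (r.choose j : ℝ) * (-1) ^ j
        * ∫ t in 0..τ, lam * t * Real.exp (-(lam * (((n : ℝ) - r + 1 + j) * t))) := by
  have hm1 : MeasurableSet {p : ℝ × ℝ | 0 ≤ p.1} := measurableSet_le (by fun_prop) (by fun_prop)
  have hm2 : MeasurableSet {p : ℝ × ℝ | p.1 ≤ τ} := measurableSet_le (by fun_prop) (by fun_prop)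
  -- The condition `0 ≤ u`, almost surely true, makes the function bounded everywhere, as
  -- `integral_orderStat` requires.
  have hf : Measurable (Function.uncurry fun u _ : ℝ => if 0 ≤ u ∧ u ≤ τ then u else 0) :=
    Measurable.ite (hm1.inter hm2) measurable_fst measurable_const
  rw [integral_orderStat (f := fun u _ => if 0 ≤ u ∧ u ≤ τ then u else 0) hl hrn hf τ fun u v => by
    split_ifs with h
    · rw [abs_of_nonneg h.1]; exact h.2
    · simpa using hτ]
  have h1 : (fun t => ∫ y : Fin n → ℝ, (if countLE t y = r then
        (if 0 ≤ t ∧ t ≤ τ then t else 0) else 0) ∂(sampleLaw n lam))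
      =ᵐ[expMeasure lam] (Set.Iic τ).indicator fun t => t * ∑ j ∈ Finset.range (r + 1),
        (n.choose r : ℝ) * (r.choose j : ℝ) * (-1) ^ j
          * Real.exp (-(lam * (((n : ℝ) - r + j) * t))) := by
    filter_upwards [ae_pos_expMeasure lam] with t ht
    by_cases htτ : t ≤ τ
    · rw [Set.indicator_of_mem (show t ∈ Set.Iic τ from htτ), ← integral_countLE_eq hl ht.le,
        ← integral_const_mul]
      refine integral_congr_ae (.of_forall fun y => ?_)
      simp [htτ, ht.le]
    · simp [htτ]
  rw [integral_congr_ae h1, integral_indicator measurableSet_Iic, setIntegral_Iic_expMeasure hl hτ]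
  have h2 : ∀ t : ℝ, lam * Real.exp (-(lam * t)) * (t * ∑ j ∈ Finset.range (r + 1),
        (n.choose r : ℝ) * (r.choose j : ℝ) * (-1) ^ j
          * Real.exp (-(lam * (((n : ℝ) - r + j) * t))))
      = ∑ j ∈ Finset.range (r + 1), (n.choose r : ℝ) * (r.choose j : ℝ) * (-1) ^ j
        * (lam * t * Real.exp (-(lam * (((n : ℝ) - r + 1 + j) * t)))) := by
    intro t
    rw [Finset.mul_sum, Finset.mul_sum]
    refine Finset.sum_congr rfl fun j _ => ?_
    rw [show -(lam * (((n : ℝ) - r + 1 + j) * t))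
        = -(lam * t) + -(lam * (((n : ℝ) - r + j) * t)) by ring, Real.exp_add]
    ring
  simp only [h2]
  rw [intervalIntegral.integral_finsetSum
    fun j _ => (Continuous.intervalIntegrable (by fun_prop) 0 τ).const_mul _]
  simp only [intervalIntegral.integral_const_mul]
  rw [mul_assoc, Finset.mul_sum _ _ (n.choose r : ℝ)]
  congr 1
  refine Finset.sum_congr rfl fun j _ => ?_
  ring

/-! ### Integrability -/

lemma expMeasure_eq_map {lam : ℝ} (hl : 0 < lam) :
    expMeasure lam = (expMeasure 1).map fun x => x / lam := by
  have h1 := isProbabilityMeasure_expMeasure hl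
  have h2 := isProbabilityMeasure_expMeasure one_pos
  have hm : Measurable fun x : ℝ => x / lam := by fun_prop
  have h3 : IsProbabilityMeasure ((expMeasure 1).map fun x => x / lam) :=
    Measure.isProbabilityMeasure_map hm.aemeasurable
  refine Measure.eq_of_cdf _ _ (StieltjesFunction.ext fun x => ?_)
  have h4 : cdf ((expMeasure 1).map fun x => x / lam) x = cdf (expMeasure 1) (lam * x) := by
    rw [cdf_eq_real, cdf_eq_real, map_measureReal_apply hm measurableSet_Iic]
    congr 1
    ext y
    simp [div_le_iff₀ hl, mul_comm]
  rw [h4, cdf_expMeasure_eq hl, cdf_expMeasure_eq one_pos, one_mul]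
  simp [mul_nonneg_iff_of_pos_left hl]

lemma sampleLaw_eq_map {lam : ℝ} (hl : 0 < lam) (n : ℕ) :
    sampleLaw n lam = (sampleLaw n 1).map fun x i => x i / lam := by
  have h2 := isProbabilityMeasure_expMeasure one_pos
  have hm : Measurable fun x : ℝ => x / lam := by fun_prop
  have h3 : IsProbabilityMeasure ((expMeasure 1).map fun x => x / lam) :=
    Measure.isProbabilityMeasure_map hm.aemeasurable
  rw [sampleLaw, sampleLaw, Measure.pi_map_pi fun _ => hm.aemeasurable, expMeasure_eq_map hl]

/-- The measure depends on `λ`. Writing the sample as a rate-`1` sample divided by `λ` moves this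
dependence into the integrand, where Fubini's measurability applies. -/
lemma aestronglyMeasurable_integral_sampleLaw (a b : ℝ) {n : ℕ} {f : ℝ → (Fin n → ℝ) → ℝ}
    (hf : Measurable (Function.uncurry f)) :
    AEStronglyMeasurable (fun lam => ∫ x, f lam x ∂(sampleLaw n lam)) (gammaMeasure a b) := by
  have h2 := isProbabilityMeasure_sampleLaw one_pos n
  have h1 : Measurable fun p : ℝ × (Fin n → ℝ) => f p.1 fun i => p.2 i / p.1 :=
    hf.comp (g := Function.uncurry f)
      (f := fun p : ℝ × (Fin n → ℝ) => ((p.1, fun i => p.2 i / p.1) : ℝ × (Fin n → ℝ)))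
      (by fun_prop)
  have h3 := (h1.stronglyMeasurable.integral_prod_right' (ν := sampleLaw n 1)).aestronglyMeasurable
    (μ := gammaMeasure a b)
  refine h3.congr ?_
  filter_upwards [ae_pos_gammaMeasure a b] with lam hl
  rw [sampleLaw_eq_map hl, integral_map]
  · exact Measurable.aemeasurable (by fun_prop)
  · exact (hf.comp (measurable_const.prodMk measurable_id)).aestronglyMeasurable

lemma bayesIntegrable_of_bound {a b : ℝ} (ha : 0 < a) (hb : 0 < b) {n : ℕ}
    {f : ℝ → (Fin n → ℝ) → ℝ} (hf : Measurable (Function.uncurry f)) (K : ℝ)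
    (hK : ∀ lam x, 0 < lam → (∀ i, 0 < x i) → |f lam x| ≤ K * (1 + lam + lam ^ 2)) :
    BayesIntegrable a b n f := by
  have h0 : ∀ lam, 0 < lam → Integrable (f lam) (sampleLaw n lam) := by
    intro lam hl
    have := isProbabilityMeasure_sampleLaw hl n
    refine Integrable.of_bound
      (hf.comp (measurable_const.prodMk measurable_id)).aestronglyMeasurable
      (K * (1 + lam + lam ^ 2)) ?_
    filter_upwards [ae_pos_sampleLaw hl n] with x hx using hK lam x hl hx
  have h1 : Integrable (fun lam => ∫ x, |f lam x| ∂(sampleLaw n lam)) (gammaMeasure a b) := by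
    have hpm := isProbabilityMeasure_gammaMeasure ha hb
    have hi := integrable_pow_gammaMeasure ha hb
    have hb2 : Integrable (fun lam => K * (1 + lam + lam ^ 2)) (gammaMeasure a b) := by
      refine Integrable.const_mul (((integrable_const 1).add ?_).add (hi 2)) K
      simpa using hi 1
    refine hb2.mono' (aestronglyMeasurable_integral_sampleLaw a b (f := fun lam x => |f lam x|)
      (continuous_abs.measurable.comp hf)) ?_
    filter_upwards [ae_pos_gammaMeasure a b] with lam hl
    have := isProbabilityMeasure_sampleLaw hl n
    rw [Real.norm_of_nonneg (integral_nonneg fun x => abs_nonneg _)]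
    calc ∫ x, |f lam x| ∂(sampleLaw n lam)
        ≤ ∫ _, K * (1 + lam + lam ^ 2) ∂(sampleLaw n lam) := by
          refine integral_mono_ae (h0 lam hl).abs (integrable_const _) ?_
          filter_upwards [ae_pos_sampleLaw hl n] with x hx using hK lam x hl hx
      _ = K * (1 + lam + lam ^ 2) := by simp
  refine ⟨h0, h1, h1.mono (aestronglyMeasurable_integral_sampleLaw a b hf) ?_⟩
  refine .of_forall fun lam => ?_
  rw [Real.norm_of_nonneg (integral_nonneg fun x => abs_nonneg _)]
  exact abs_integral_le_integral_abs

lemma orderStat_pos {n k : ℕ} {x : Fin n → ℝ} (hx : ∀ i, 0 < x i) (hk : 1 ≤ k) (hkn : k ≤ n) :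
    0 < orderStat x k := by
  obtain ⟨i, hi⟩ := exists_eq_orderStat x hk hkn
  rw [hi]
  exact hx i

lemma abs_duration_le {n r : ℕ} {τ : ℝ} {x : Fin n → ℝ} (hx : ∀ i, 0 < x i) (hr : 1 ≤ r)
    (hrn : r ≤ n) (hτ : 0 < τ) : |duration r τ x| ≤ τ := by
  rw [duration, abs_of_nonneg (le_min (orderStat_pos hx hr hrn).le hτ.le)]
  exact min_le_right _ _

lemma numFailures_le {n : ℕ} (r : ℕ) (τ : ℝ) (x : Fin n → ℝ) : (numFailures r τ x : ℝ) ≤ r := by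
  rw [numFailures_eq]
  exact_mod_cast min_le_left _ _

lemma bayesIntegrable_numFailures {a b : ℝ} (ha : 0 < a) (hb : 0 < b) (n r : ℕ) (τ : ℝ) :
    BayesIntegrable a b n fun _ x => (numFailures r τ x : ℝ) := by
  refine bayesIntegrable_of_bound ha hb
    (measurable_from_nat.comp ((measurable_numFailures r τ).comp measurable_snd)) r
    fun lam x hl _ => ?_
  rw [abs_of_nonneg (Nat.cast_nonneg _)]
  refine (numFailures_le r τ x).trans (le_mul_of_one_le_right (Nat.cast_nonneg _) ?_)
  nlinarith [sq_nonneg lam]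

lemma bayesIntegrable_duration {a b : ℝ} (ha : 0 < a) (hb : 0 < b) {n r : ℕ} (hr : 1 ≤ r)
    (hrn : r ≤ n) {τ : ℝ} (hτ : 0 < τ) : BayesIntegrable a b n fun _ x => duration r τ x := by
  refine bayesIntegrable_of_bound ha hb ((measurable_duration r τ).comp measurable_snd) τ
    fun lam x hl hx => ?_
  refine (abs_duration_le hx hr hrn hτ).trans (le_mul_of_one_le_right hτ.le ?_)
  nlinarith [sq_nonneg lam]

/-- The indicator of rejection. -/
noncomputable def rejectInd {n : ℕ} (r : ℕ) (τ ζ : ℝ) (x : Fin n → ℝ) : ℝ :=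
  if rateEstimator r τ x < ζ then 0 else 1

@[fun_prop]
lemma measurable_rejectInd {n : ℕ} (r : ℕ) (τ ζ : ℝ) :
    Measurable (rejectInd r τ ζ : (Fin n → ℝ) → ℝ) :=
  Measurable.ite (measurableSet_lt (measurable_rateEstimator r τ) measurable_const)
    measurable_const measurable_const

lemma abs_rejectInd_le {n : ℕ} (r : ℕ) (τ ζ : ℝ) (x : Fin n → ℝ) : |rejectInd r τ ζ x| ≤ 1 := by
  unfold rejectInd
  split_ifs <;> simp

/-- The cost of acceptance is charged always, and rejection adds the difference of costs; this is
the source of the coefficients `C_l`. -/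
lemma loss_eq {c : Costs} {n r : ℕ} {τ ζ lam : ℝ} {x : Fin n → ℝ} :
    loss c n r τ ζ lam x = n * (c.Cs - c.rs) + c.rs * numFailures r τ x + c.Ct * duration r τ x
      + (c.a₀ + c.a₁ * lam + c.a₂ * lam ^ 2)
      + (c.Cr - c.a₀ - c.a₁ * lam - c.a₂ * lam ^ 2) * rejectInd r τ ζ x := by
  rw [loss, decision, rejectInd]
  split_ifs <;> simp only [actionCost] <;> ring

lemma bayesIntegrable_loss (c : Costs) {a b : ℝ} (ha : 0 < a) (hb : 0 < b) {n r : ℕ} (hr : 1 ≤ r)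
    (hrn : r ≤ n) {τ : ℝ} (hτ : 0 < τ) (ζ : ℝ) : BayesIntegrable a b n (loss c n r τ ζ) := by
  refine bayesIntegrable_of_bound ha hb ?_ (|(n : ℝ) * (c.Cs - c.rs)| + |c.rs| * r + |c.Ct| * τ
    + (|c.a₀| + |c.a₁| + |c.a₂|) + (|c.Cr| + |c.a₀| + |c.a₁| + |c.a₂|)) fun lam x hl hx => ?_
  · have h1 : Measurable fun p : ℝ × (Fin n → ℝ) => (numFailures r τ p.2 : ℝ) :=
      measurable_from_nat.comp ((measurable_numFailures r τ).comp measurable_snd)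
    have h2 : Function.uncurry (loss c n r τ ζ) = fun p => n * (c.Cs - c.rs)
        + c.rs * numFailures r τ p.2 + c.Ct * duration r τ p.2
        + (c.a₀ + c.a₁ * p.1 + c.a₂ * p.1 ^ 2)
        + (c.Cr - c.a₀ - c.a₁ * p.1 - c.a₂ * p.1 ^ 2) * rejectInd r τ ζ p.2 :=
      funext fun p => loss_eq
    rw [h2]
    have h3 : Measurable fun p : ℝ × (Fin n → ℝ) => duration r τ p.2 :=
      (measurable_duration r τ).comp measurable_snd
    have h4 : Measurable fun p : ℝ × (Fin n → ℝ) => rejectInd r τ ζ p.2 :=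
      (measurable_rejectInd r τ ζ).comp measurable_snd
    fun_prop
  · have hP : 1 ≤ 1 + lam + lam ^ 2 := by nlinarith [sq_nonneg lam]
    have hP1 : lam ≤ 1 + lam + lam ^ 2 := by nlinarith [sq_nonneg lam]
    have hP2 : lam ^ 2 ≤ 1 + lam + lam ^ 2 := by nlinarith [sq_nonneg lam]
    have t1 : |(n : ℝ) * (c.Cs - c.rs)| ≤ |(n : ℝ) * (c.Cs - c.rs)| * (1 + lam + lam ^ 2) :=
      le_mul_of_one_le_right (abs_nonneg _) hP
    have t2 : |c.rs * numFailures r τ x| ≤ |c.rs| * r * (1 + lam + lam ^ 2) := by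
      rw [abs_mul, abs_of_nonneg (Nat.cast_nonneg (α := ℝ) _)]
      refine (mul_le_mul_of_nonneg_left (numFailures_le r τ x) (abs_nonneg _)).trans
        (le_mul_of_one_le_right (by positivity) hP)
    have t3 : |c.Ct * duration r τ x| ≤ |c.Ct| * τ * (1 + lam + lam ^ 2) := by
      rw [abs_mul]
      exact (mul_le_mul_of_nonneg_left (abs_duration_le hx hr hrn hτ) (abs_nonneg _)).trans
        (le_mul_of_one_le_right (by positivity) hP)
    have q0 : ∀ y : ℝ, |y| ≤ |y| * (1 + lam + lam ^ 2) := fun y =>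
      le_mul_of_one_le_right (abs_nonneg _) hP
    have q1 : ∀ y : ℝ, |y * lam| ≤ |y| * (1 + lam + lam ^ 2) := fun y => by
      rw [abs_mul, abs_of_pos hl]
      exact mul_le_mul_of_nonneg_left hP1 (abs_nonneg _)
    have q2 : ∀ y : ℝ, |y * lam ^ 2| ≤ |y| * (1 + lam + lam ^ 2) := fun y => by
      rw [abs_mul, abs_of_pos (pow_pos hl 2)]
      exact mul_le_mul_of_nonneg_left hP2 (abs_nonneg _)
    have t4 : |c.a₀ + c.a₁ * lam + c.a₂ * lam ^ 2|
        ≤ (|c.a₀| + |c.a₁| + |c.a₂|) * (1 + lam + lam ^ 2) := by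
      refine (abs_add_three _ _ _).trans ?_
      linarith [q0 c.a₀, q1 c.a₁, q2 c.a₂]
    have t5 : |(c.Cr - c.a₀ - c.a₁ * lam - c.a₂ * lam ^ 2) * rejectInd r τ ζ x|
        ≤ (|c.Cr| + |c.a₀| + |c.a₁| + |c.a₂|) * (1 + lam + lam ^ 2) := by
      rw [abs_mul]
      refine (mul_le_of_le_one_right (abs_nonneg _) (abs_rejectInd_le r τ ζ x)).trans ?_
      have e1 := abs_sub (c.Cr - c.a₀ - c.a₁ * lam) (c.a₂ * lam ^ 2)
      have e2 := abs_sub (c.Cr - c.a₀) (c.a₁ * lam)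
      have e3 := abs_sub c.Cr c.a₀
      linarith [q0 c.Cr, q0 c.a₀, q1 c.a₁, q2 c.a₂]
    rw [loss_eq]
    refine (abs_add_le _ _).trans ?_
    refine (add_le_add_left (abs_add_le _ _) _).trans ?_
    have := abs_add_three ((n : ℝ) * (c.Cs - c.rs)) (c.rs * numFailures r τ x)
      (c.Ct * duration r τ x)
    linarith

/-! ### The rejection event -/

lemma zetaStar_pos {n : ℕ} (hn : 1 ≤ n) {τ : ℝ} (hτ : 0 < τ) (ζ : ℝ) : 0 < zetaStar n τ ζ := by
  have : (0 : ℝ) < n := by exact_mod_cast hn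
  exact lt_max_of_lt_left (by positivity)

/-- Since `1 / (n τ) ≤ m / T` holds anyway, raising `ζ` to `ζ*` changes nothing, and it permits
division even when `ζ = 0`. -/
lemma le_div_iff_le_div_zetaStar {n : ℕ} (hn : 1 ≤ n) {τ ζ T : ℝ} (hτ : 0 < τ) (hT : 0 < T)
    (hTn : T ≤ n * τ) {m : ℕ} (hm : 1 ≤ m) :
    ζ ≤ m / T ↔ T ≤ m / zetaStar n τ ζ := by
  have hn0 : (0 : ℝ) < n := by exact_mod_cast hn
  have hm1 : (1 : ℝ) ≤ m := by exact_mod_cast hm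
  rw [le_div_iff₀ (zetaStar_pos hn hτ ζ), mul_comm, ← le_div_iff₀ hT, zetaStar, max_le_iff]
  refine ⟨fun h => ⟨?_, h⟩, fun h => h.2⟩
  exact div_le_div₀ (by positivity) hm1 hT hTn

lemma rejectInd_eq {n r : ℕ} (hr : 1 ≤ r) (hrn : r ≤ n) {τ ζ : ℝ} (hτ : 0 < τ) (hζ : 0 ≤ ζ)
    {x : Fin n → ℝ} (hx : ∀ i, 0 < x i) :
    rejectInd r τ ζ x = (if ζ = 0 then (if countLE τ x = 0 then (1 : ℝ) else 0) else 0)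
      + ∑ m ∈ Finset.Icc 1 (r - 1),
        countInd τ m (Set.Iic (m / zetaStar n τ ζ - ((n : ℝ) - m) * τ)) x
      + (if orderStat x r ≤ τ ∧ (∑ i ∈ Finset.Icc 1 r, orderStat x i)
          + ((n : ℝ) - r) * orderStat x r ≤ r / zetaStar n τ ζ then 1 else 0) := by
  have hn : 1 ≤ n := hr.trans hrn
  have hCn : (countLE τ x : ℝ) ≤ n := by exact_mod_cast countLE_le τ x
  rw [rejectInd, rateEstimator_eq, timeOnTest, numFailures_eq]
  rcases lt_or_ge (countLE τ x) r with hC | hC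
  · rw [if_neg (c := _ ∧ _) fun h => absurd ((orderStat_le_iff x hr hrn τ).1 h.1) (not_le.2 hC),
      if_pos hC, min_eq_right hC.le, add_zero]
    rcases Nat.eq_zero_or_pos (countLE τ x) with h0 | h0
    · rw [Finset.sum_eq_zero, h0]
      · rcases hζ.eq_or_lt with hz | hz
        · simp [← hz]
        · simp [hz, hz.ne']
      · intro m hm
        rw [countInd, if_neg]
        rw [Finset.mem_Icc] at hm
        omega
    · rw [if_neg h0.ne', ite_self, zero_add, Finset.sum_eq_single (countLE τ x)]
      · have hsum : sumLE τ x ≤ countLE τ x * τ := by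
          rw [sumLE, countLE]
          push_cast
          rw [Finset.sum_mul]
          refine Finset.sum_le_sum fun i _ => ?_
          split_ifs with h <;> simp [h]
        have hpos : 0 < sumLE τ x := by
          rw [← sum_orderStat]
          refine Finset.sum_pos (fun i hi => ?_) ⟨1, Finset.mem_Icc.2 ⟨le_rfl, h0⟩⟩
          rw [Finset.mem_Icc] at hi
          exact orderStat_pos hx hi.1 (hi.2.trans (countLE_le τ x))
        have hT : 0 < sumLE τ x + ((n : ℝ) - countLE τ x) * τ :=
          add_pos_of_pos_of_nonneg hpos (mul_nonneg (by linarith) hτ.le)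
        have hiff := le_div_iff_le_div_zetaStar (ζ := ζ) hn hτ hT (by linarith) h0
        rw [countInd]
        simp only [Set.mem_Iic, le_sub_iff_add_le, ← hiff, true_and]
        by_cases h : ζ ≤ countLE τ x / (sumLE τ x + ((n : ℝ) - countLE τ x) * τ)
        · rw [if_neg (not_lt.2 h), if_pos h]
        · rw [if_pos (not_le.1 h), if_neg h]
      · intro m _ hm
        rw [countInd, if_neg fun h => hm h.1.symm]
      · intro h
        rw [Finset.mem_Icc] at h
        omega
  · have hz : ∑ m ∈ Finset.Icc 1 (r - 1),
        countInd τ m (Set.Iic (m / zetaStar n τ ζ - ((n : ℝ) - m) * τ)) x = 0 := by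
      refine Finset.sum_eq_zero fun m hm => ?_
      rw [countInd, if_neg]
      rw [Finset.mem_Icc] at hm
      omega
    have h0 : countLE τ x ≠ 0 := by omega
    rw [hz, if_neg (not_lt.2 hC), min_eq_left hC, if_neg h0, ite_self, zero_add, zero_add]
    have hrn' : (r : ℝ) ≤ n := by exact_mod_cast hrn
    have hle : orderStat x r ≤ τ := (orderStat_le_iff x hr hrn τ).2 hC
    have hpos : 0 < ∑ i ∈ Finset.Icc 1 r, orderStat x i := by
      refine Finset.sum_pos (fun i hi => ?_) ⟨1, Finset.mem_Icc.2 ⟨le_rfl, hr⟩⟩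
      rw [Finset.mem_Icc] at hi
      exact orderStat_pos hx hi.1 (hi.2.trans hrn)
    have hsum : ∑ i ∈ Finset.Icc 1 r, orderStat x i ≤ r * τ := by
      refine (Finset.sum_le_card_nsmul _ _ τ fun i hi => ?_).trans (by simp)
      rw [Finset.mem_Icc] at hi
      exact (orderStat_le_iff x hi.1 (hi.2.trans hrn) τ).2 (hi.2.trans hC)
    have h1 := mul_le_mul_of_nonneg_left hle (sub_nonneg.2 hrn')
    have hT : 0 < (∑ i ∈ Finset.Icc 1 r, orderStat x i) + ((n : ℝ) - r) * orderStat x r :=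
      add_pos_of_pos_of_nonneg hpos
        (mul_nonneg (sub_nonneg.2 hrn') (orderStat_pos hx hr hrn).le)
    have hiff := le_div_iff_le_div_zetaStar (ζ := ζ) hn hτ hT (by linarith) hr
    simp only [hle, true_and, ← hiff]
    split_ifs with h2 h3 h3
    · exact absurd h2 (not_lt.2 h3)
    · rfl
    · rfl
    · exact absurd (not_lt.1 h2) h3

lemma sum_Icc_one_eq_sum_range (f : ℕ → ℝ) (r : ℕ) :
    ∑ k ∈ Finset.Icc 1 r, f k = ∑ j ∈ Finset.range r, f (j + 1) := by
  rw [Finset.range_eq_Ico, Finset.sum_Ico_add' f]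
  rfl

/-- For the rate `lam`, the probability that `(n - m + j) τ` is exceeded by one exponential variable
and that this time and `m` further variables add up to at most `m / ζ*`. -/
noncomputable def timeProb (n : ℕ) (τ ζ lam : ℝ) (j : ℤ) (m : ℕ) : ℝ :=
  Real.exp (-(lam * (((n : ℝ) - m + j) * τ)))
    * sumCDF m lam (m / zetaStar n τ ζ - ((n : ℝ) - m + j) * τ)

/-- This is `hasMean_sumCDF` with `c = (n - m + j) τ` and `u = m / ζ* - c`: then `b + c = C_{j,m}`
and `u / (b + c + u) = S*_{j,m}`. -/
lemma hasMean_timeProb {a b : ℝ} (ha : 0 < a) (hb : 0 < b) {n : ℕ} (hn : 1 ≤ n) {τ : ℝ}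
    (hτ : 0 < τ) (ζ : ℝ) (l : ℕ) {j : ℤ} {m : ℕ} (hm : 1 ≤ m) (hj : (0 : ℝ) ≤ (n : ℝ) - m + j) :
    HasMean (gammaMeasure a b) (fun lam => lam ^ l * timeProb n τ ζ lam j m)
      (b ^ a / Real.Gamma a * rLJM a b n τ ζ l j m) := by
  have hm0 : (0 : ℝ) < m := by exact_mod_cast hm
  have hz := zetaStar_pos hn hτ ζ
  have hc : 0 ≤ ((n : ℝ) - m + j) * τ := mul_nonneg hj hτ.le
  have hsum : b + ((n : ℝ) - m + j) * τ + (m / zetaStar n τ ζ - ((n : ℝ) - m + j) * τ)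
      = b + m / zetaStar n τ ζ := by ring
  have hpos : 0 < b + m / zetaStar n τ ζ := by positivity
  have h := hasMean_sumCDF ha hb hc l hm (hsum.symm ▸ hpos)
  have hC : cJM b n τ j m = b + ((n : ℝ) - m + j) * τ := by
    rw [cJM, tauJM]
    field_simp
  have hC0 : 0 < b + ((n : ℝ) - m + j) * τ := by positivity
  have hS : sStarJM b n τ ζ j m = (m / zetaStar n τ ζ - ((n : ℝ) - m + j) * τ)
      / (b + ((n : ℝ) - m + j) * τ + (m / zetaStar n τ ζ - ((n : ℝ) - m + j) * τ)) := by
    have h1 : cStarJM b n τ ζ j m = (m / zetaStar n τ ζ - ((n : ℝ) - m + j) * τ)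
        / (b + ((n : ℝ) - m + j) * τ) := by
      rw [cStarJM, hC, tauJM]
      congr 1
      field_simp
    have h2 : 1 + (m / zetaStar n τ ζ - ((n : ℝ) - m + j) * τ) / (b + ((n : ℝ) - m + j) * τ)
        = (b + ((n : ℝ) - m + j) * τ + (m / zetaStar n τ ζ - ((n : ℝ) - m + j) * τ))
          / (b + ((n : ℝ) - m + j) * τ) := by
      rw [add_div, div_self hC0.ne']
    rw [sStarJM, h1, h2, div_div_div_cancel_right₀ hC0.ne']
  rw [rLJM, hS, hC]
  exact h

/-- The probability of rejection for the failure rate `lam`. -/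
noncomputable def rejectProb (n r : ℕ) (τ ζ lam : ℝ) : ℝ :=
  (if ζ = 0 then Real.exp (-(lam * (n * τ))) else 0)
    + (∑ m ∈ Finset.Icc 1 (r - 1), ∑ j ∈ Finset.range (m + 1),
        (n.choose m : ℝ) * (m.choose j : ℝ) * (-1) ^ j * timeProb n τ ζ lam (j : ℤ) m)
    + timeProb n τ ζ lam ((r : ℤ) - (n : ℤ)) r
    + ∑ k ∈ Finset.Icc 1 r, (n.choose r : ℝ) * ((r - 1).choose (k - 1) : ℝ) * (-1) ^ k
        * ((r : ℝ) / ((n : ℝ) - r + k)) * timeProb n τ ζ lam (k : ℤ) r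

theorem integral_rejectInd {n r : ℕ} (hr : 1 ≤ r) (hrn : r ≤ n) {τ ζ lam : ℝ} (hτ : 0 < τ)
    (hζ : 0 ≤ ζ) (hl : 0 < lam) :
    ∫ x : Fin n → ℝ, rejectInd r τ ζ x ∂(sampleLaw n lam) = rejectProb n r τ ζ lam := by
  have h1 : (fun x : Fin n → ℝ => rejectInd r τ ζ x) =ᵐ[sampleLaw n lam] fun x =>
      ((if ζ = 0 then (if countLE τ x = 0 then (1 : ℝ) else 0) else 0)
      + ∑ m ∈ Finset.Icc 1 (r - 1),
        countInd τ m (Set.Iic (m / zetaStar n τ ζ - ((n : ℝ) - m) * τ)) x)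
      + (if orderStat x r ≤ τ ∧ (∑ i ∈ Finset.Icc 1 r, orderStat x i)
          + ((n : ℝ) - r) * orderStat x r ≤ r / zetaStar n τ ζ then 1 else 0) := by
    filter_upwards [ae_pos_sampleLaw hl n] with x hx using rejectInd_eq hr hrn hτ hζ hx
  have i1 : Integrable (fun x : Fin n → ℝ =>
      if ζ = 0 then (if countLE τ x = 0 then (1 : ℝ) else 0) else 0) (sampleLaw n lam) := by
    refine integrable_of_bounded hl ?_ 1 fun x => by split_ifs <;> simp
    by_cases hz : ζ = 0
    · simp only [hz, if_true]
      exact Measurable.ite (measurableSet_eq_fun (measurable_countLE τ) measurable_const)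
        measurable_const measurable_const
    · simp only [hz, if_false]
      exact measurable_const
  have i2 : ∀ m ∈ Finset.Icc 1 (r - 1), Integrable (fun x : Fin n → ℝ =>
      countInd τ m (Set.Iic (m / zetaStar n τ ζ - ((n : ℝ) - m) * τ)) x) (sampleLaw n lam) :=
    fun m _ => integrable_countInd hl τ m measurableSet_Iic
  have i3 : Integrable (fun x : Fin n → ℝ => if orderStat x r ≤ τ ∧
      (∑ i ∈ Finset.Icc 1 r, orderStat x i) + ((n : ℝ) - r) * orderStat x r
        ≤ r / zetaStar n τ ζ then (1 : ℝ) else 0) (sampleLaw n lam) := by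
    have hm : Measurable fun x : Fin n → ℝ =>
        (∑ i ∈ Finset.Icc 1 r, orderStat x i) + ((n : ℝ) - r) * orderStat x r := by fun_prop
    refine integrable_of_bounded hl ?_ 1 fun x => by split_ifs <;> simp
    exact Measurable.ite ((measurableSet_le (measurable_orderStat r) measurable_const).inter
      (measurableSet_le hm measurable_const)) measurable_const measurable_const
  have i4 : Integrable (fun x : Fin n → ℝ =>
      (if ζ = 0 then (if countLE τ x = 0 then (1 : ℝ) else 0) else 0)
        + ∑ m ∈ Finset.Icc 1 (r - 1),
          countInd τ m (Set.Iic (m / zetaStar n τ ζ - ((n : ℝ) - m) * τ)) x) (sampleLaw n lam) :=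
    i1.add (integrable_finsetSum _ i2)
  rw [integral_congr_ae h1, integral_add i4 i3,
    integral_add i1 (integrable_finsetSum _ i2), integral_finsetSum _ i2, rejectProb,
    add_assoc _ (timeProb n τ ζ lam ((r : ℤ) - (n : ℤ)) r)]
  congr 1
  · congr 1
    · split_ifs with hz
      · rw [integral_countLE_eq hl hτ.le]
        simp
      · simp
    · refine Finset.sum_congr rfl fun m _ => ?_
      rw [integral_countInd hl hτ.le (isShiftFamily_Iic hl), truncSum, Finset.mul_sum]
      refine Finset.sum_congr rfl fun j _ => ?_
      rw [timeProb, Int.cast_natCast, show -(lam * (((n : ℝ) - m + j) * τ))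
        = -(lam * ((n - m) * τ)) + -(lam * (j * τ)) by ring, Real.exp_add, add_mul, sub_sub]
      ring_nf
  · obtain ⟨r, rfl⟩ := Nat.exists_eq_add_of_le' hr
    obtain ⟨n, rfl⟩ := Nat.exists_eq_add_of_le' (hr.trans hrn)
    have hrn' : r ≤ n := by omega
    have h2 := integral_orderStat_le hl hτ.le hrn' ((r + 1 : ℕ) / zetaStar (n + 1) τ ζ)
    have h3 : ((n + 1 : ℕ) : ℝ) - (r + 1 : ℕ) = n - r := by push_cast; ring
    simp only [h3]
    rw [h2, sum_Icc_one_eq_sum_range, sub_eq_add_neg, ← Finset.sum_neg_distrib]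
    congr 1
    -- For `j = r - n` and `m = r` the delay `(n - m + j) τ` is zero, so only the distribution
    -- function of the sum remains.
    · rw [timeProb]
      push_cast
      simp
    · refine Finset.sum_congr rfl fun j _ => ?_
      -- Absorption of the binomial coefficient produces the factor `r` of the formula; the shift `k
      -- = j + 1` takes up the minus sign.
      have h4 : ((n : ℝ) + 1) * n.choose r = (n + 1).choose (r + 1) * ((r : ℝ) + 1) := by
        exact_mod_cast Nat.add_one_mul_choose_eq n r
      have h5 : ((n + 1 : ℕ) : ℝ) - (r + 1 : ℕ) + ((j + 1 : ℕ) : ℤ) = (n : ℝ) - r + 1 + j := by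
        push_cast; ring
      have h6 : (n : ℝ) - r + (j + 1 : ℕ) = (n : ℝ) - r + 1 + j := by push_cast; ring
      rw [timeProb, h5, h6, h4, Nat.add_sub_cancel, Nat.add_sub_cancel, pow_succ]
      push_cast
      ring

theorem hasMean_rejectProb {a b : ℝ} (ha : 0 < a) (hb : 0 < b) {n r : ℕ} (hr : 1 ≤ r)
    (hrn : r ≤ n) {τ : ℝ} (hτ : 0 < τ) (ζ : ℝ) (l : ℕ) :
    HasMean (gammaMeasure a b) (fun lam => lam ^ l * rejectProb n r τ ζ lam)
      (b ^ a / Real.Gamma a *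
        ((if ζ = 0 then Real.Gamma (a + l) / (b + n * τ) ^ (a + l) else 0)
          + (∑ m ∈ Finset.Icc 1 (r - 1), ∑ j ∈ Finset.range (m + 1),
              (n.choose m : ℝ) * (m.choose j : ℝ) * (-1) ^ j * rLJM a b n τ ζ l (j : ℤ) m)
          + rLJM a b n τ ζ l ((r : ℤ) - (n : ℤ)) r
          + ∑ k ∈ Finset.Icc 1 r, (n.choose r : ℝ) * ((r - 1).choose (k - 1) : ℝ) * (-1) ^ k
              * ((r : ℝ) / ((n : ℝ) - r + k)) * rLJM a b n τ ζ l (k : ℤ) r)) := by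
  have hn := hr.trans hrn
  have hrn' : (r : ℝ) ≤ n := by exact_mod_cast hrn
  have m0 : HasMean (gammaMeasure a b)
      (fun lam => lam ^ l * if ζ = 0 then Real.exp (-(lam * (n * τ))) else 0)
      (b ^ a / Real.Gamma a *
        if ζ = 0 then Real.Gamma (a + l) / (b + n * τ) ^ (a + l) else 0) := by
    split_ifs
    · exact hasMean_pow_mul_exp ha hb (by positivity) l
    · constructor <;> simp
  have m1 := HasMean.sum (μ := gammaMeasure a b) (Finset.Icc 1 (r - 1)) fun m hm =>
    HasMean.sum (Finset.range (m + 1)) fun j _ =>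
      (hasMean_timeProb ha hb hn hτ ζ l (j := (j : ℤ)) (m := m) (Finset.mem_Icc.1 hm).1
        (by
          have h1 : (m : ℝ) ≤ n := by
            have := (Finset.mem_Icc.1 hm).2
            exact_mod_cast (by omega : m ≤ n)
          have h2 : (0 : ℝ) ≤ ((j : ℤ) : ℝ) := by simp
          linarith)).const_mul ((n.choose m : ℝ) * (m.choose j : ℝ) * (-1) ^ j)
  have m2 := hasMean_timeProb ha hb hn hτ ζ l (j := (r : ℤ) - (n : ℤ)) (m := r) hr
    (by push_cast; linarith)
  have m3 := HasMean.sum (μ := gammaMeasure a b) (Finset.Icc 1 r) fun k _ =>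
    (hasMean_timeProb ha hb hn hτ ζ l (j := (k : ℤ)) (m := r) hr
      (by
        have h2 : (0 : ℝ) ≤ ((k : ℤ) : ℝ) := by simp
        linarith)).const_mul
      ((n.choose r : ℝ) * ((r - 1).choose (k - 1) : ℝ) * (-1) ^ k * ((r : ℝ) / ((n : ℝ) - r + k)))
  have h := ((m0.add m1).add m2).add m3
  convert! h using 1
  · funext lam
    rw [rejectProb]
    simp only [mul_add, Finset.mul_sum]
    congr 1
    · congr 2
      refine Finset.sum_congr rfl fun m _ => Finset.sum_congr rfl fun j _ => ?_
      ring
    · refine Finset.sum_congr rfl fun k _ => ?_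
      ring
  · simp only [mul_add, Finset.mul_sum]
    congr 1
    · congr 2
      refine Finset.sum_congr rfl fun m _ => Finset.sum_congr rfl fun j _ => ?_
      ring
    · refine Finset.sum_congr rfl fun k _ => ?_
      ring

/-! ### Closed forms of `E(M)`, `E(τ*)` and the Bayes risk -/

lemma bayesExp_eq_of_hasMean {a b v : ℝ} {n : ℕ} {f : ℝ → (Fin n → ℝ) → ℝ} {g : ℝ → ℝ}
    (h : ∀ lam, 0 < lam → ∫ x, f lam x ∂(sampleLaw n lam) = g lam)
    (hg : HasMean (gammaMeasure a b) g v) : bayesExp a b n f = v := by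
  refine (integral_congr_ae ?_).trans hg.2
  filter_upwards [ae_pos_gammaMeasure a b] with lam hl using h lam hl

theorem hasMean_count {a b : ℝ} (ha : 0 < a) (hb : 0 < b) (n : ℕ) {τ : ℝ} (hτ : 0 ≤ τ)
    (g : ℕ → ℝ) :
    HasMean (gammaMeasure a b)
      (fun lam => ∑ m ∈ Finset.range (n + 1), ∑ j ∈ Finset.range (m + 1),
        g m * (n.choose m : ℝ) * (m.choose j : ℝ) * (-1) ^ j
          * Real.exp (-(lam * (((n : ℝ) - m + j) * τ))))
      (∑ m ∈ Finset.range (n + 1), ∑ j ∈ Finset.range (m + 1),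
        g m * (n.choose m : ℝ) * (m.choose j : ℝ) * (-1) ^ j
          * (b ^ a / (b + ((n : ℝ) - m + j) * τ) ^ a)) := by
  refine HasMean.sum _ fun m hm => HasMean.sum _ fun j _ => (hasMean_exp ha hb ?_).const_mul _
  have h1 : (m : ℝ) ≤ n := by
    have := Finset.mem_range.1 hm
    exact_mod_cast (by omega : m ≤ n)
  have h2 : (0 : ℝ) ≤ j := Nat.cast_nonneg _
  exact mul_nonneg (by linarith) hτ

theorem expFailures_eq {a b : ℝ} (ha : 0 < a) (hb : 0 < b) {n r : ℕ} (hr : 1 ≤ r) (hrn : r ≤ n)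
    {τ : ℝ} (hτ : 0 ≤ τ) :
    expFailures a b n r τ =
      (∑ m ∈ Finset.Icc 1 (r - 1), ∑ j ∈ Finset.range (m + 1),
          (m : ℝ) * (n.choose m : ℝ) * (m.choose j : ℝ) * (-1) ^ j
            * (b ^ a / (b + ((n : ℝ) - m + j) * τ) ^ a))
        + ∑ k ∈ Finset.Icc r n, ∑ j ∈ Finset.range (k + 1),
          (r : ℝ) * (n.choose k : ℝ) * (k.choose j : ℝ) * (-1) ^ j
            * (b ^ a / (b + ((n : ℝ) - k + j) * τ) ^ a) := by
  rw [expFailures, bayesExp_eq_of_hasMean (fun lam hl => ?_)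
    (hasMean_count ha hb n hτ fun m => ((min r m : ℕ) : ℝ))]
  · rw [Finset.range_eq_Ico, ← Finset.sum_Ico_consecutive _ (Nat.zero_le r) (by omega : r ≤ n + 1),
      Finset.sum_eq_sum_Ico_succ_bot (by omega : 0 < r)]
    have h1 : Finset.Icc 1 (r - 1) = Finset.Ico (0 + 1) r := by
      ext m
      simp only [Finset.mem_Icc, Finset.mem_Ico]
      omega
    have h2 : Finset.Icc r n = Finset.Ico r (n + 1) := rfl
    rw [h1, h2]
    simp only [Nat.min_zero, Nat.cast_zero, zero_mul, Finset.sum_const_zero, zero_add]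
    congr 1
    · refine Finset.sum_congr rfl fun m hm => ?_
      rw [min_eq_right (Finset.mem_Ico.1 hm).2.le]
    · refine Finset.sum_congr rfl fun m hm => ?_
      rw [min_eq_left (Finset.mem_Ico.1 hm).1]
  · simp only [numFailures_eq]
    exact integral_comp_countLE hl hτ n fun m => ((min r m : ℕ) : ℝ)

lemma duration_eq {n r : ℕ} (hr : 1 ≤ r) (hrn : r ≤ n) (τ : ℝ) {x : Fin n → ℝ}
    (hx : ∀ i, 0 < x i) :
    duration r τ x = (if 0 ≤ orderStat x r ∧ orderStat x r ≤ τ then orderStat x r else 0)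
      + if countLE τ x < r then τ else 0 := by
  have h0 := orderStat_pos hx hr hrn
  have h := orderStat_le_iff x hr hrn τ
  rw [duration]
  by_cases hc : countLE τ x < r
  · have h1 : ¬ orderStat x r ≤ τ := fun h2 => absurd (h.1 h2) (not_le.2 hc)
    rw [if_neg fun h2 => h1 h2.2, if_pos hc, zero_add, min_eq_right (not_le.1 h1).le]
  · have h1 := h.2 (not_lt.1 hc)
    rw [if_pos ⟨h0.le, h1⟩, if_neg hc, add_zero, min_eq_left h1]

theorem expDuration_eq {a b : ℝ} (ha : 0 < a) (ha1 : a ≠ 1) (hb : 0 < b) {n r : ℕ} (hr : 1 ≤ r)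
    (hrn : r ≤ n) {τ : ℝ} (hτ : 0 ≤ τ) :
    expDuration a b n r τ =
      (r : ℝ) * (n.choose r : ℝ) * (∑ j ∈ Finset.range r,
          ((r - 1).choose j : ℝ) * (-1) ^ (r - 1 - j)
            * (b / (((n : ℝ) - j) ^ 2 * (a - 1))
              - τ * b ^ a / (((n : ℝ) - j) * (((n : ℝ) - j) * τ + b) ^ a)
              - b ^ a / (((n : ℝ) - j) ^ 2 * (a - 1) * (((n : ℝ) - j) * τ + b) ^ (a - 1))))
        + ∑ k ∈ Finset.range r, ∑ j ∈ Finset.range (k + 1),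
          τ * (n.choose k : ℝ) * (k.choose j : ℝ) * (-1) ^ j
            * (b ^ a / (b + ((n : ℝ) - k + j) * τ) ^ a) := by
  have m1 := (HasMean.sum (μ := gammaMeasure a b) (Finset.range r) fun j hj =>
    (hasMean_truncated_moment ha ha1 hb (c := (n : ℝ) - j) (by
      have : (j : ℝ) < n := by exact_mod_cast (Finset.mem_range.1 hj).trans_le hrn
      linarith) hτ).const_mul
      (((r - 1).choose j : ℝ) * (-1) ^ (r - 1 - j))).const_mul ((r : ℝ) * (n.choose r : ℝ))
  have m2 := hasMean_count ha hb n hτ fun m => if m < r then τ else 0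
  rw [expDuration, bayesExp_eq_of_hasMean (fun lam hl => ?_) (m1.add m2)]
  · congr 1
    rw [← Finset.sum_subset (Finset.range_subset_range.2 (by omega : r ≤ n + 1))]
    · refine Finset.sum_congr rfl fun m hm => ?_
      rw [if_pos (Finset.mem_range.1 hm)]
    · intro m _ hm
      rw [if_neg fun h => hm (Finset.mem_range.2 h)]
      simp
  · have h1 : (fun x : Fin n → ℝ => duration r τ x) =ᵐ[sampleLaw n lam] fun x =>
        (if 0 ≤ orderStat x r ∧ orderStat x r ≤ τ then orderStat x r else 0)
          + if countLE τ x < r then τ else 0 := by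
      filter_upwards [ae_pos_sampleLaw hl n] with x hx using duration_eq hr hrn τ hx
    have i1 : Integrable (fun x : Fin n → ℝ =>
        if 0 ≤ orderStat x r ∧ orderStat x r ≤ τ then orderStat x r else 0)
        (sampleLaw n lam) := by
      refine integrable_of_bounded hl ?_ τ fun x => ?_
      · exact Measurable.ite ((measurableSet_le measurable_const (measurable_orderStat r)).inter
          (measurableSet_le (measurable_orderStat r) measurable_const)) (measurable_orderStat r)
          measurable_const
      · split_ifs with h
        · rw [abs_of_nonneg h.1]; exact h.2
        · simpa using hτ
    have i2 : Integrable (fun x : Fin n → ℝ => if countLE τ x < r then τ else 0)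
        (sampleLaw n lam) := by
      refine integrable_of_bounded hl ?_ τ fun x => ?_
      · exact Measurable.ite (measurableSet_lt (measurable_countLE τ) measurable_const)
          measurable_const measurable_const
      · split_ifs
        · rw [abs_of_nonneg hτ]
        · simpa using hτ
    rw [integral_congr_ae h1, integral_add i1 i2]
    congr 1
    · obtain ⟨r, rfl⟩ := Nat.exists_eq_add_of_le' hr
      obtain ⟨n, rfl⟩ := Nat.exists_eq_add_of_le' (hr.trans hrn)
      have hrn' : r ≤ n := by omega
      have h4 : ((n : ℝ) + 1) * n.choose r = ((r + 1 : ℕ) : ℝ) * (n + 1).choose (r + 1) := by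
        rw [mul_comm ((r + 1 : ℕ) : ℝ)]
        exact_mod_cast Nat.add_one_mul_choose_eq n r
      -- Reversing the summation turns the rates `n - r + 1 + j` into the `n - j` of the formula,
      -- with `n` and `r` standing for the original values.
      rw [integral_orderStat_truncated hl hτ hrn', h4, ← Finset.sum_range_reflect]
      congr 1
      refine Finset.sum_congr rfl fun j hj => ?_
      have hj' : j ≤ r := Nat.lt_succ_iff.1 (Finset.mem_range.1 hj)
      have h5 : r + 1 - 1 - j = r - j := by omega
      have h6 : (n : ℝ) - r + 1 + (r - j : ℕ) = (n + 1 : ℕ) - j := by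
        push_cast [hj']
        ring
      rw [h5, h6, Nat.choose_symm hj', Nat.add_sub_cancel]
    · exact integral_comp_countLE hl hτ n fun m => if m < r then τ else 0

theorem bayesRisk_eq (c : Costs) {a b : ℝ} (ha : 0 < a) (hb : 0 < b) {n r : ℕ} (hr : 1 ≤ r)
    (hrn : r ≤ n) {τ ζ : ℝ} (hτ : 0 < τ) (hζ : 0 ≤ ζ) :
    bayesRisk c a b n r τ ζ = n * (c.Cs - c.rs) + expFailures a b n r τ * c.rs
      + expDuration a b n r τ * c.Ct + c.a₀ + c.a₁ * priorMoment a b 1 + c.a₂ * priorMoment a b 2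
      + ∑ l : Fin 3, riskCoeff c l
        * ∫ lam, lam ^ (l : ℕ) * rejectProb n r τ ζ lam ∂(gammaMeasure a b) := by
  have hpm := isProbabilityMeasure_gammaMeasure ha hb
  have hM := bayesIntegrable_numFailures ha hb n r τ
  have hD := bayesIntegrable_duration ha hb hr hrn hτ
  have mk : ∀ {f : ℝ → ℝ}, Integrable f (gammaMeasure a b) →
      HasMean (gammaMeasure a b) f (∫ lam, f lam ∂(gammaMeasure a b)) := fun h => ⟨h, rfl⟩
  -- Only the integrability is needed here; the values of these integrals enter in the final
  -- theorem.
  have hR := fun l : ℕ => mk (hasMean_rejectProb ha hb hr hrn hτ ζ l).1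
  have h := ((((mk (integrable_const (n * (c.Cs - c.rs) + c.a₀))).add
    ((mk hM.2.2).const_mul c.rs)).add ((mk hD.2.2).const_mul c.Ct)).add
    (((mk (integrable_pow_gammaMeasure ha hb 1)).const_mul c.a₁).add
      ((mk (integrable_pow_gammaMeasure ha hb 2)).const_mul c.a₂))).add
    ((((hR 0).const_mul (c.Cr - c.a₀)).add ((hR 1).const_mul (-c.a₁))).add
      ((hR 2).const_mul (-c.a₂)))
  rw [bayesRisk, bayesExp_eq_of_hasMean (fun lam hl => ?_) h]
  · have h0 : riskCoeff c 0 = c.Cr - c.a₀ := rfl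
    have h1 : riskCoeff c 1 = -c.a₁ := rfl
    have h2 : riskCoeff c 2 = -c.a₂ := rfl
    simp only [integral_const, probReal_univ, one_smul, Fin.sum_univ_three,
      expFailures, expDuration, bayesExp, priorMoment, Fin.val_zero, Fin.val_one, Fin.val_two,
      h0, h1, h2]
    ring
  · have hpl := isProbabilityMeasure_sampleLaw hl n
    have i1 := (hM.1 lam hl).const_mul c.rs
    have i2 := (hD.1 lam hl).const_mul c.Ct
    have i3 : Integrable (fun x : Fin n → ℝ => rejectInd r τ ζ x) (sampleLaw n lam) :=
      integrable_of_bounded hl (measurable_rejectInd r τ ζ) 1 (abs_rejectInd_le r τ ζ)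
    simp only [loss_eq]
    rw [integral_add, integral_add, integral_add, integral_add, integral_const_mul c.rs,
      integral_const_mul c.Ct, integral_const_mul (c.Cr - c.a₀ - c.a₁ * lam - c.a₂ * lam ^ 2),
      integral_rejectInd hr hrn hτ hζ hl]
    · simp only [integral_const, probReal_univ, one_smul]
      ring
    · exact integrable_const _
    · exact i1
    · exact (integrable_const _).add i1
    · exact i2
    · exact ((integrable_const _).add i1).add i2
    · exact integrable_const _
    · exact (((integrable_const _).add i1).add i2).add (integrable_const _)
    · exact i3.const_mul _

end HybridPlan

theorem theorem4p1 (c : HybridPlan.Costs) (a b : ℝ) (ha : 0 < a) (hb : 0 < b)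
    (n r : ℕ) (hr : 1 ≤ r) (hrn : r ≤ n) (τ ζ : ℝ) (hτ : 0 < τ) (hζ : 0 ≤ ζ) :
    -- all expectations are those of integrable functions
    HybridPlan.BayesIntegrable a b n (HybridPlan.loss c n r τ ζ) ∧
    HybridPlan.BayesIntegrable a b n (fun _ x => (HybridPlan.numFailures r τ x : ℝ)) ∧
    HybridPlan.BayesIntegrable a b n (fun _ x => HybridPlan.duration r τ x) ∧
    (∀ i : ℕ, i ≤ 2 → MeasureTheory.Integrable (fun lam : ℝ => lam ^ i)
      (ProbabilityTheory.gammaMeasure a b)) ∧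
    -- the Bayes risk
    HybridPlan.bayesRisk c a b n r τ ζ =
      n * (c.Cs - c.rs) + HybridPlan.expFailures a b n r τ * c.rs
        + HybridPlan.expDuration a b n r τ * c.Ct
        + c.a₀ + c.a₁ * HybridPlan.priorMoment a b 1 + c.a₂ * HybridPlan.priorMoment a b 2
        + ∑ l : Fin 3, HybridPlan.riskCoeff c l * (b ^ a / Real.Gamma a) *
          ((if ζ = 0 then Real.Gamma (a + (l : ℕ)) / (b + n * τ) ^ (a + (l : ℕ)) else 0)
            + (∑ m ∈ Finset.Icc 1 (r - 1), ∑ j ∈ Finset.range (m + 1),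
                (n.choose m : ℝ) * (m.choose j : ℝ) * (-1) ^ j
                  * HybridPlan.rLJM a b n τ ζ l (j : ℤ) m)
            + HybridPlan.rLJM a b n τ ζ l ((r : ℤ) - (n : ℤ)) r
            + ∑ k ∈ Finset.Icc 1 r,
                (n.choose r : ℝ) * ((r - 1).choose (k - 1) : ℝ) * (-1) ^ k
                  * ((r : ℝ) / ((n : ℝ) - r + k)) * HybridPlan.rLJM a b n τ ζ l (k : ℤ) r) ∧
    -- the expected number of failures
    HybridPlan.expFailures a b n r τ =
      (∑ m ∈ Finset.Icc 1 (r - 1), ∑ j ∈ Finset.range (m + 1),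
          (m : ℝ) * (n.choose m : ℝ) * (m.choose j : ℝ) * (-1) ^ j
            * (b ^ a / (b + ((n : ℝ) - m + j) * τ) ^ a))
        + ∑ k ∈ Finset.Icc r n, ∑ j ∈ Finset.range (k + 1),
          (r : ℝ) * (n.choose k : ℝ) * (k.choose j : ℝ) * (-1) ^ j
            * (b ^ a / (b + ((n : ℝ) - k + j) * τ) ^ a) ∧
    -- the expected duration, whose formula has the factor `a - 1` in denominators
    (a ≠ 1 → HybridPlan.expDuration a b n r τ =
      (r : ℝ) * (n.choose r : ℝ) * (∑ j ∈ Finset.range r,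
          ((r - 1).choose j : ℝ) * (-1) ^ (r - 1 - j)
            * (b / (((n : ℝ) - j) ^ 2 * (a - 1))
              - τ * b ^ a / (((n : ℝ) - j) * (((n : ℝ) - j) * τ + b) ^ a)
              - b ^ a / (((n : ℝ) - j) ^ 2 * (a - 1) * (((n : ℝ) - j) * τ + b) ^ (a - 1))))
        + ∑ k ∈ Finset.range r, ∑ j ∈ Finset.range (k + 1),
          τ * (n.choose k : ℝ) * (k.choose j : ℝ) * (-1) ^ j
            * (b ^ a / (b + ((n : ℝ) - k + j) * τ) ^ a)) := by

  refine ⟨HybridPlan.bayesIntegrable_loss c ha hb hr hrn hτ ζ,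
    HybridPlan.bayesIntegrable_numFailures ha hb n r τ,
    HybridPlan.bayesIntegrable_duration ha hb hr hrn hτ,
    fun i _ => HybridPlan.integrable_pow_gammaMeasure ha hb i, ?_,
    HybridPlan.expFailures_eq ha hb hr hrn hτ.le,
    fun ha1 => HybridPlan.expDuration_eq ha ha1 hb hr hrn hτ.le⟩
  rw [HybridPlan.bayesRisk_eq c ha hb hr hrn hτ hζ]
  simp only [(HybridPlan.hasMean_rejectProb ha hb hr hrn hτ ζ _).2, mul_assoc]
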